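/- Let $n\ge 2$ and let $P=P_1P_2\dots P_{2n}$ be a non-degenerate (strictly) convex polygon in $\mathbb R^2$, symmetric about the origin ($P_{i+n}=-P_i$ for all $i\in\mathbb Z$), with vertices in counter-clockwise order. Write $[v,w]$ for the determinant of $v,w\in\mathbb R^2$, let $Q$ be the dual polygon, given by $[P_i,Q_i]=1$ and $[P_{i+1}-P_i,Q_i]=0$, and put $\alpha_i=1/[Q_i,Q_{i+1}]$, $\beta_i=1/[P_i,P_{i+1}]$. For $m\ge1$ let $L_{mP}$ be the space of real sequences $(r_i)_{i\in\mathbb Z}$ with $r_{i+2mn}=r_i$ ($2mn$-periodic lists of curvature radii; $P$ is traversed $m$ times), and let $T_{mP}:L_{mP}\to L_{mP}$ be the double evolute transform $$(T_{mP}r)_i=-\beta_i\big(\alpha_i(r_{i+1}-r_i)-\alpha_{i-1}(r_i-r_{i-1})\big),\qquad T_P=T_{1P}.$$ A non-zero $r$ with $T_{mP}r=\lambda r$ is called a hypocycloid if $0<\lambda<1$, a cycloid if $\lambda=1$ and an epicycloid if $\lambda>1$. **Proposition.** There are real numbers $\lambda^1_p,\lambda^2_p$, indexed by rational $p\in[0,n]$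 and depending only on $P$ (not on $m$), with $\lambda^1_0=\lambda^2_0=:\lambda_0=0$, $\lambda^1_n=\lambda^2_n=:\lambda_n$ and $\lambda^1_1=\lambda^2_1=1$, such that: 1. the $2n$ eigenvalues of $T_P$, listed with multiplicity (that is, there is a basis of eigenvectors with these eigenvalues), are $$\lambda_0(=0)<\lambda^1_1=\lambda^2_1(=1)<\lambda^1_2\le\lambda^2_2<\dots<\lambda^1_{n-1}\le\lambda^2_{n-1}<\lambda_n;$$ 2. for every $m\ge1$, the $2mn$ eigenvalues of $T_{mP}$, listed with multiplicity in the same sense, are $\lambda_0$, the pairs $\lambda^1_{k/m},\lambda^2_{k/m}$ for $k=1,\dots,mn-1$, and $\lambda_n$; they satisfy $\lambda^2_{k/m}<\lambda^1_{(k+1)/m}$ for $0\le k<mn$, and $\lambda^1_{k/m}=\lambda^2_{k/m}$ whenever $k/m$ is not an integer, in which case this eigenvalue is exactly double (its eigenspace has dimension $2$). Thus $$\lambda_0(=0)<\lambda^1_{1/m}=\lambda^2_{1/m}<\dots<\lambda^1_{1-1/m}=\lambda^2_{1-1/m}<\lambda^1_1=\lambda^2_1(=1)<\lambda^1_{1+1/m}=\lambda^2_{1+1/m}<\dots<\lambda^1_{2-1/m}=\lambda^2_{2-1/m}<\lambda^1_2\le\lambda^2_2<\dots<\lambda^1_{n-1/m}=\lambda^2_{n-1/m}<\lambda_n,$$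 with the eigenvalues of $T_P$ at the integer indices; 3. for every $m\ge1$, the hypocycloids of $T_{mP}$ span a space of dimension $2m-2$, the cycloids one of dimension $2$, and the epicycloids one of dimension $2mn-2m-1$. -/

import Mathlib

/-- The determinant `[v, w]` of the `2 × 2` matrix with columns `v` and `w`. -/
def det2 (v w : ℝ × ℝ) : ℝ := v.1 * w.2 - v.2 * w.1

/-- A plane, symmetric, non-degenerate convex polygon `P = P₁ P₂ … P₂ₙ`, with its vertices listed
once in counter-clockwise order; the list of vertices is extended to all integer indices
(`P (i + n) = -P i`, hence with period `2n`). Convexity: for every side `[P i, P (i + 1)]`, each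
vertex which is not an end of this side lies strictly to the left of it. -/
structure SymmetricConvexPolygon (n : ℕ) where
  vertex : ℤ → ℝ × ℝ
  two_le : 2 ≤ n
  symm : ∀ i : ℤ, vertex (i + n) = -vertex i
  convex : ∀ i j : ℤ, ¬ (j ≡ i [ZMOD (2 * n : ℤ)]) → ¬ (j ≡ i + 1 [ZMOD (2 * n : ℤ)]) →
    0 < det2 (vertex (i + 1) - vertex i) (vertex j - vertex i)

namespace SymmetricConvexPolygon

variable {n : ℕ} (P : SymmetricConvexPolygon n)

/-- The vertices `Q i` of the dual polygon `Q`. That they are the only points with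
`[P i, Q i] = 1` and `[P (i + 1) - P i, Q i] = 0` is `isDual_iff` below. -/
noncomputable def dual (i : ℤ) : ℝ × ℝ :=
  (1 / det2 (P.vertex i) (P.vertex (i + 1))) • (P.vertex (i + 1) - P.vertex i)

/-- `α i = 1 / [Q i, Q (i + 1)]`. -/
noncomputable def alpha (i : ℤ) : ℝ := 1 / det2 (P.dual i) (P.dual (i + 1))

/-- `β i = 1 / [P i, P (i + 1)]`. -/
noncomputable def beta (i : ℤ) : ℝ := 1 / det2 (P.vertex i) (P.vertex (i + 1))

theorem det_pos (i : ℤ) : 0 < det2 (P.vertex i) (P.vertex (i + 1)) := by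
  have hn := P.two_le
  have h := P.convex i (i + n) (by
      intro h
      have h3 : (2 * n : ℤ) ∣ n := by
        have := (dvd_neg).2 h.dvd
        simpa using this
      have := Int.le_of_dvd (by omega) h3
      omega) (by
      intro h
      have h3 : (2 * n : ℤ) ∣ n - 1 := by
        have := (dvd_neg).2 h.dvd
        have e : -(i + 1 - (i + (n : ℤ))) = n - 1 := by ring
        rwa [e] at this
      have := Int.le_of_dvd (by omega) h3
      omega)
  rw [P.symm i] at h
  simp only [det2, Prod.fst_sub, Prod.snd_sub, Prod.fst_neg, Prod.snd_neg] at h ⊢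
  linarith

theorem isDual_iff (i : ℤ) (q : ℝ × ℝ) :
    (det2 (P.vertex i) q = 1 ∧ det2 (P.vertex (i + 1) - P.vertex i) q = 0) ↔ q = P.dual i := by
  have h := (P.det_pos i).ne'
  have key : ∀ a b c d x y : ℝ, a * d - b * c ≠ 0 →
      ((a * y - b * x = 1 ∧ (c - a) * y - (d - b) * x = 0) ↔
        (x = (a * d - b * c)⁻¹ * (c - a) ∧ y = (a * d - b * c)⁻¹ * (d - b))) := by
    intro a b c d x y h
    constructor
    · rintro ⟨h1, h2⟩
      constructor
      · rw [eq_inv_mul_iff_mul_eq₀ h]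
        linear_combination (c - a) * h1 - a * h2
      · rw [eq_inv_mul_iff_mul_eq₀ h]
        linear_combination (d - b) * h1 - b * h2
    · rintro ⟨rfl, rfl⟩
      constructor
      · field_simp
        ring
      · ring
  simpa [det2, dual, Prod.ext_iff] using
    key (P.vertex i).1 (P.vertex i).2 (P.vertex (i + 1)).1 (P.vertex (i + 1)).2 q.1 q.2 h

theorem vertex_periodic : Function.Periodic P.vertex (2 * n : ℤ) := by
  intro i
  have e : i + (2 * n : ℤ) = (i + n) + n := by ring
  rw [e, P.symm, P.symm, neg_neg]

theorem vertex_add_period (m : ℕ) (i : ℤ) : P.vertex (i + ((2 * m * n : ℕ) : ℤ)) = P.vertex i := by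
  have h := P.vertex_periodic.int_mul m i
  have e : ((2 * m * n : ℕ) : ℤ) = (m : ℤ) * (2 * n) := by push_cast; ring
  rw [e]
  exact h

theorem dual_add_period (m : ℕ) (i : ℤ) : P.dual (i + ((2 * m * n : ℕ) : ℤ)) = P.dual i := by
  simp only [dual, add_right_comm i _ 1, vertex_add_period]

theorem alpha_add_period (m : ℕ) (i : ℤ) : P.alpha (i + ((2 * m * n : ℕ) : ℤ)) = P.alpha i := by
  simp only [alpha, add_right_comm i _ 1, dual_add_period]

theorem beta_add_period (m : ℕ) (i : ℤ) : P.beta (i + ((2 * m * n : ℕ) : ℤ)) = P.beta i := by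
  simp only [beta, add_right_comm i _ 1, vertex_add_period]

/-- The evolute transform in terms of curvature radii: `s i = α i * (r (i + 1) - r i)`. -/
noncomputable def evolute : (ℤ → ℝ) →ₗ[ℝ] (ℤ → ℝ) where
  toFun r i := P.alpha i * (r (i + 1) - r i)
  map_add' r s := by ext i; simp only [Pi.add_apply]; ring
  map_smul' c r := by ext i; simp only [Pi.smul_apply, smul_eq_mul, RingHom.id_apply]; ring

/-- The second evolute transform (with respect to the dual polygon) in terms of curvature radii:
`t i = -β i * (s i - s (i - 1))`. -/
noncomputable def dualEvolute : (ℤ → ℝ) →ₗ[ℝ] (ℤ → ℝ) where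
  toFun s i := -P.beta i * (s i - s (i - 1))
  map_add' r s := by ext i; simp only [Pi.add_apply]; ring
  map_smul' c r := by ext i; simp only [Pi.smul_apply, smul_eq_mul, RingHom.id_apply]; ring

end SymmetricConvexPolygon

/-- The space of `N`-periodic lists of curvature radii. For `N = 2mn` this is `L_{mP}`. -/
def radiiSpace (N : ℕ) : Submodule ℝ (ℤ → ℝ) where
  carrier := {r | ∀ i : ℤ, r (i + N) = r i}
  add_mem' := by
    intro r s hr hs i
    simp only [Pi.add_apply, hr i, hs i]
  zero_mem' := by
    intro i
    rfl
  smul_mem' := by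
    intro c r hr i
    simp only [Pi.smul_apply, hr i]

namespace SymmetricConvexPolygon

variable {n : ℕ} (P : SymmetricConvexPolygon n)

theorem dualEvolute_evolute_mem (m : ℕ) :
    ∀ r ∈ radiiSpace (2 * m * n), (P.dualEvolute ∘ₗ P.evolute) r ∈ radiiSpace (2 * m * n) := by
  intro r hr i
  have h : ∀ j : ℤ, r (j + ((2 * m * n : ℕ) : ℤ)) = r j := hr
  have e : i + ((2 * m * n : ℕ) : ℤ) - 1 = (i - 1) + ((2 * m * n : ℕ) : ℤ) := by ring
  simp only [LinearMap.comp_apply, dualEvolute, evolute, LinearMap.coe_mk, AddHom.coe_mk, e,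
    add_right_comm _ ((2 * m * n : ℕ) : ℤ) 1, alpha_add_period, beta_add_period, h]

/-- The double evolute transform `T_{mP}` on the `2mn`-periodic lists of radii, where `mP` is the
polygon `P` traversed `m` times. In particular `T_P` is the case `m = 1`. -/
noncomputable def doubleEvolute (m : ℕ) :
    radiiSpace (2 * m * n) →ₗ[ℝ] radiiSpace (2 * m * n) :=
  (P.dualEvolute ∘ₗ P.evolute).restrict (P.dualEvolute_evolute_mem m)

/-- The space spanned by the hypocycloids (eigenvectors with eigenvalue in `(0, 1)`) of `T_{mP}`. -/
noncomputable def hypocycloids (m : ℕ) : Submodule ℝ (radiiSpace (2 * m * n)) :=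
  ⨆ x ∈ Set.Ioo (0 : ℝ) 1, Module.End.eigenspace (P.doubleEvolute m) x

/-- The space of the (ordinary) cycloids of `T_{mP}` (eigenvectors with eigenvalue `1`). -/
noncomputable def cycloids (m : ℕ) : Submodule ℝ (radiiSpace (2 * m * n)) :=
  Module.End.eigenspace (P.doubleEvolute m) 1

/-- The space spanned by the epicycloids (eigenvectors with eigenvalue `> 1`) of `T_{mP}`. -/
noncomputable def epicycloids (m : ℕ) : Submodule ℝ (radiiSpace (2 * m * n)) :=
  ⨆ x ∈ Set.Ioi (1 : ℝ), Module.End.eigenspace (P.doubleEvolute m) x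

end SymmetricConvexPolygon

/-- `ν` lists the `N` eigenvalues of `T`, each as often as its multiplicity: the space has a basis
of `N` eigenvectors of `T` with these eigenvalues. -/
def IsEigenvalueList {V : Type*} [AddCommGroup V] [Module ℝ V] (T : V →ₗ[ℝ] V) {N : ℕ}
    (ν : Fin N → ℝ) : Prop :=
  ∃ b : Module.Basis (Fin N) ℝ V, ∀ j, T (b j) = ν j • b j

/-- The list `lam2 0, lam1 (1/m), lam2 (1/m), lam1 (2/m), lam2 (2/m), …` (positions `0, 1, 2, …`).
Its first `2mn` terms end with `…, lam1 (n - 1/m), lam2 (n - 1/m), lam1 n`. -/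
noncomputable def interleave (m : ℕ) (lam1 lam2 : ℚ → ℝ) (j : ℕ) : ℝ :=
  if Even j then lam2 (((j / 2 : ℕ) : ℚ) / m) else lam1 ((((j + 1) / 2 : ℕ) : ℚ) / m)

/-! This is Floquet theory for a discrete Sturm–Liouville equation. With `s i = α (i - 1) * (r i - r
(i - 1))`, the equation `T r = z r` becomes a first-order system in `(r, s)`. By central symmetry
its coefficients have period `n`, not just `2n`. Let `M(z)` be its monodromy over `n` steps; `det M
= 1`, and the trace `D(z)` is a polynomial of degree `n`. Fixed vectors of `M(z) ^ (2m)` give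
eigenvectors of `T_{mP}`, and such vectors exist when `D(z) = 2 cos (π k / m)`. So `λ_p` is defined
by `D(λ_p) = 2 cos (π p)`, which does not involve `m`.

The shape of `D` carries the proof. Its roots are real by self-adjointness
(`im_eq_zero_of_aeval_discriminant`). At a point with `|D| ≤ 2` and `D' = 0` the monodromy is scalar
(`transferMatrix_eq_of_derivative_eq_zero`), so `|D| ≥ 2` at every critical point. Hence `[0, ∞)`
begins with `n` consecutive intervals on which `D` is monotone and takes each value of `[-2, 2]`
once (`exists_isBandPartition`). For non-integer `p` there is one `λ_p`; at an interior integer, two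
neighbouring bands give `λ¹_p ≤ λ²_p`, with equality only at a critical point.

For `z = 1` the solutions are linear functions of the dual vertices, so `M(1) = -1`, `D(1) = -2` and
`D'(1) = 0`. Convexity makes `[Q 0, Q i]` positive for `0 < i < n`, and a Jacobi-type argument
(`one_le_of_antiperiodic`) shows that `1` is the least root of `D = -2`. Thus `λ¹_1 = λ²_1 = 1`.

Multiplicities come from counting: a value listed once has an eigenvector, a value listed twice has
`M ^ (2m) = 1` and so two independent ones, and the list has as many terms as the dimension
(`isEigenvalueList_of_card_le`). -/

open Polynomial

/-! ### Transfer matrices of the first-order system -/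

/-- The matrix of the first `k` steps `(r, s) ↦ (r + a i * s', s')`, `s' = s - z * b i * r`. -/
noncomputable def transferMatrix {K : Type*} [CommRing K] [Algebra ℝ K] (a b : ℕ → ℝ) (z : K) :
    ℕ → Matrix (Fin 2) (Fin 2) K
  | 0 => 1
  | k + 1 => !![1 - z * algebraMap ℝ K (a k) * algebraMap ℝ K (b k), algebraMap ℝ K (a k);
      -z * algebraMap ℝ K (b k), 1] * transferMatrix a b z k

section Transfer

variable {K : Type*} [CommRing K] [Algebra ℝ K] {a b : ℕ → ℝ} {z : K}

@[simp] theorem transferMatrix_zero : transferMatrix a b z 0 = 1 := rfl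

theorem transferMatrix_succ (k : ℕ) : transferMatrix a b z (k + 1) =
    !![1 - z * algebraMap ℝ K (a k) * algebraMap ℝ K (b k), algebraMap ℝ K (a k);
      -z * algebraMap ℝ K (b k), 1] * transferMatrix a b z k := rfl

theorem transferMatrix_succ_one (k : ℕ) (j : Fin 2) : transferMatrix a b z (k + 1) 1 j =
    transferMatrix a b z k 1 j - z * algebraMap ℝ K (b k) * transferMatrix a b z k 0 j := by
  simp [transferMatrix_succ, Matrix.mul_apply, Fin.sum_univ_two]
  ring

theorem transferMatrix_succ_zero (k : ℕ) (j : Fin 2) : transferMatrix a b z (k + 1) 0 j =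
    transferMatrix a b z k 0 j + algebraMap ℝ K (a k) * transferMatrix a b z (k + 1) 1 j := by
  simp [transferMatrix_succ, Matrix.mul_apply, Fin.sum_univ_two]
  ring

theorem det_transferMatrix (k : ℕ) : (transferMatrix a b z k).det = 1 := by
  induction k with
  | zero => simp
  | succ k ih =>
    rw [transferMatrix_succ, Matrix.det_mul, ih, Matrix.det_fin_two_of]
    ring

theorem transferMatrix_det_eq (k : ℕ) :
    transferMatrix a b z k 0 0 * transferMatrix a b z k 1 1 -
      transferMatrix a b z k 0 1 * transferMatrix a b z k 1 0 = 1 := by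
  rw [← Matrix.det_fin_two, det_transferMatrix]

/-- Lets one definition serve for polynomial, real and complex parameters: it is applied to
evaluation at a point and to complex conjugation. -/
theorem transferMatrix_map {L : Type*} [CommRing L] [Algebra ℝ L] (f : K →ₐ[ℝ] L) (k : ℕ)
    (i j : Fin 2) : f (transferMatrix a b z k i j) = transferMatrix a b (f z) k i j := by
  induction k generalizing i with
  | zero => fin_cases i <;> fin_cases j <;> simp
  | succ k ih =>
    have h1 : f (transferMatrix a b z (k + 1) 1 j) = transferMatrix a b (f z) (k + 1) 1 j := by
      simp [transferMatrix_succ_one, ih]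
    fin_cases i
    · simp [transferMatrix_succ_zero, ih, h1]
    · exact h1

theorem transferMatrix_add {n : ℕ} (ha : ∀ i, a (i + n) = a i) (hb : ∀ i, b (i + n) = b i) (k : ℕ) :
    transferMatrix a b z (k + n) = transferMatrix a b z k * transferMatrix a b z n := by
  induction k with
  | zero => simp
  | succ k ih => rw [Nat.add_right_comm, transferMatrix_succ, transferMatrix_succ, ih, ha, hb,
      Matrix.mul_assoc]

theorem transferMatrix_mul {n : ℕ} (ha : ∀ i, a (i + n) = a i) (hb : ∀ i, b (i + n) = b i) (k : ℕ) :
    transferMatrix a b z (k * n) = transferMatrix a b z n ^ k := by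
  induction k with
  | zero => simp
  | succ k ih => rw [Nat.succ_mul, transferMatrix_add ha hb, ih, pow_succ]

/-- The discrete Lagrange identity. -/
theorem transferMatrix_lagrange (w : K) (u v : Fin 2 → K) (k : ℕ) :
    (transferMatrix a b w k).mulVec u 0 * (transferMatrix a b z k).mulVec v 1 -
      (transferMatrix a b w k).mulVec u 1 * (transferMatrix a b z k).mulVec v 0 =
    u 0 * v 1 - u 1 * v 0 - (z - w) * ∑ i ∈ Finset.range k, algebraMap ℝ K (b i) *
      ((transferMatrix a b w i).mulVec u 0 * (transferMatrix a b z i).mulVec v 0) := by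
  induction k with
  | zero => simp
  | succ k ih =>
    rw [Finset.sum_range_succ, mul_add, ← sub_sub, ← ih]
    simp only [Matrix.mulVec, dotProduct, Fin.sum_univ_two, transferMatrix_succ_zero,
      transferMatrix_succ_one]
    ring

end Transfer

/-! ### The discriminant: derivative, degree, reality of its roots -/

/-- The discriminant of the `n`-periodic system, as a polynomial in the spectral parameter. -/
noncomputable def discriminant (a b : ℕ → ℝ) (n : ℕ) : ℝ[X] := (transferMatrix a b X n).trace

section Discriminant

variable {a b : ℕ → ℝ} {n : ℕ}

theorem aeval_discriminant {K : Type*} [CommRing K] [Algebra ℝ K] (z : K) :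
    aeval z (discriminant a b n) =
      transferMatrix a b z n 0 0 + transferMatrix a b z n 1 1 := by
  rw [discriminant, Matrix.trace_fin_two, map_add, transferMatrix_map, transferMatrix_map, aeval_X]

theorem eval_discriminant (x : ℝ) : (discriminant a b n).eval x =
    transferMatrix a b x n 0 0 + transferMatrix a b x n 1 1 := by
  rw [← aeval_discriminant, coe_aeval_eq_eval]

theorem eval_transferMatrix (x : ℝ) (k : ℕ) (i j : Fin 2) :
    (transferMatrix a b (X : ℝ[X]) k i j).eval x = transferMatrix a b x k i j := by
  rw [← coe_aeval_eq_eval, transferMatrix_map, aeval_X]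

/-- The infinitesimal form of the Lagrange identity: differentiate it in one parameter and let the
two parameters coincide. -/
theorem transferMatrix_derivative (k : ℕ) (i j : Fin 2) :
    transferMatrix a b (X : ℝ[X]) k 0 i * derivative (transferMatrix a b (X : ℝ[X]) k 1 j) -
      transferMatrix a b (X : ℝ[X]) k 1 i * derivative (transferMatrix a b (X : ℝ[X]) k 0 j) =
    - ∑ l ∈ Finset.range k, C (b l) *
      (transferMatrix a b (X : ℝ[X]) l 0 i * transferMatrix a b (X : ℝ[X]) l 0 j) := by
  induction k with
  | zero => fin_cases i <;> fin_cases j <;> simp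
  | succ k ih =>
    rw [Finset.sum_range_succ, neg_add, ← ih]
    simp only [transferMatrix_succ_zero, transferMatrix_succ_one, algebraMap_eq, derivative_add,
      derivative_sub, derivative_mul, derivative_C, derivative_X]
    ring

/-- As the monodromy has determinant `1`, the four Wronskian identities can be solved for the
derivative of the trace. The result is a sum of values of one binary quadratic form whose
discriminant is `D ^ 2 - 4`. -/
theorem eval_derivative_discriminant (x : ℝ) :
    (derivative (discriminant a b n)).eval x = ∑ l ∈ Finset.range n, b l *
      (-transferMatrix a b x n 0 1 * transferMatrix a b x l 0 0 ^ 2 +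
        (transferMatrix a b x n 0 0 - transferMatrix a b x n 1 1) *
          (transferMatrix a b x l 0 0 * transferMatrix a b x l 0 1) +
        transferMatrix a b x n 1 0 * transferMatrix a b x l 0 1 ^ 2) := by
  have h (i j : Fin 2) := congrArg (eval x) (transferMatrix_derivative (a := a) (b := b) n i j)
  simp only [eval_sub, eval_mul, eval_transferMatrix, eval_neg, eval_finsetSum, eval_C] at h
  have hd := transferMatrix_det_eq (a := a) (b := b) (z := x) n
  rw [discriminant, Matrix.trace_fin_two, derivative_add, eval_add]
  have e : ∀ q0 q1 q2 : ℝ, ∑ l ∈ Finset.range n, b l * (q0 * transferMatrix a b x l 0 0 ^ 2 +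
      q1 * (transferMatrix a b x l 0 0 * transferMatrix a b x l 0 1) +
        q2 * transferMatrix a b x l 0 1 ^ 2) =
      q0 * ∑ l ∈ Finset.range n, b l * (transferMatrix a b x l 0 0 * transferMatrix a b x l 0 0) +
      q1 * ∑ l ∈ Finset.range n, b l * (transferMatrix a b x l 0 0 * transferMatrix a b x l 0 1) +
      q2 * ∑ l ∈ Finset.range n, b l *
        (transferMatrix a b x l 0 1 * transferMatrix a b x l 0 1) := by
    intro q0 q1 q2
    simp only [Finset.mul_sum, ← Finset.sum_add_distrib]
    exact Finset.sum_congr rfl fun l _ ↦ by ring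
  rw [e]
  have h10 : ∑ l ∈ Finset.range n, b l * (transferMatrix a b x l 0 1 * transferMatrix a b x l 0 0) =
      ∑ l ∈ Finset.range n, b l * (transferMatrix a b x l 0 0 * transferMatrix a b x l 0 1) :=
    Finset.sum_congr rfl fun l _ ↦ by ring
  have h1 := h 0 0
  have h2 := h 0 1
  have h3 := h 1 0
  have h4 := h 1 1
  rw [h10] at h3
  set A := transferMatrix a b x n 0 0
  set B := transferMatrix a b x n 0 1
  set C' := transferMatrix a b x n 1 0
  set E := transferMatrix a b x n 1 1
  generalize ∑ l ∈ Finset.range n, b l * (transferMatrix a b x l 0 0 * transferMatrix a b x l 0 0)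
    = G1 at *
  generalize ∑ l ∈ Finset.range n, b l * (transferMatrix a b x l 0 0 * transferMatrix a b x l 0 1)
    = G2 at *
  generalize ∑ l ∈ Finset.range n, b l * (transferMatrix a b x l 0 1 * transferMatrix a b x l 0 1)
    = G3 at *
  generalize eval x (derivative (transferMatrix a b X n 0 0)) = A' at *
  generalize eval x (derivative (transferMatrix a b X n 0 1)) = B' at *
  generalize eval x (derivative (transferMatrix a b X n 1 0)) = C'' at *
  generalize eval x (derivative (transferMatrix a b X n 1 1)) = E' at *
  linear_combination (-(A' + E')) * hd + B * h1 + E * h2 - A * h3 - C' * h4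

/-- Where the derivative of the discriminant vanishes and its absolute value is at most `2`, all
solutions are periodic or antiperiodic. -/
theorem transferMatrix_eq_of_derivative_eq_zero (hn : 2 ≤ n) (ha : ∀ i, 0 < a i)
    (hb : ∀ i, 0 < b i) {x : ℝ} (hx : |(discriminant a b n).eval x| ≤ 2)
    (h : (derivative (discriminant a b n)).eval x = 0) :
    transferMatrix a b x n 0 1 = 0 ∧ transferMatrix a b x n 1 0 = 0 ∧
      transferMatrix a b x n 0 0 = transferMatrix a b x n 1 1 := by
  have hd := transferMatrix_det_eq (a := a) (b := b) (z := x) n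
  rw [eval_discriminant] at hx
  rw [eval_derivative_discriminant] at h
  have hx2 := sq_le_sq' (by linarith [(abs_le.1 hx).1]) (abs_le.1 hx).2
  generalize transferMatrix a b x n 0 0 = A at *
  generalize transferMatrix a b x n 0 1 = B at *
  generalize transferMatrix a b x n 1 0 = C' at *
  generalize transferMatrix a b x n 1 1 = E at *
  -- The discriminant `(A - E) ^ 2 + 4 B C'` of the form equals `D ^ 2 - 4 ≤ 0`, so the form is
  -- semidefinite; its sign is that of its trace `C' - B`.
  have hq : (A - E) ^ 2 ≤ 4 * (-B * C') := by linear_combination hx2 - 4 * hd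
  by_cases hs : C' - B = 0
  · have h1 : C' = B := by linarith
    subst h1
    have h2 : C' = 0 := by nlinarith [sq_nonneg (A - E)]
    subst h2
    exact ⟨rfl, rfl, by nlinarith⟩
  have key (u v : ℝ) : 0 ≤ (C' - B) * (-B * u ^ 2 + (A - E) * (u * v) + C' * v ^ 2) := by
    have h1 : 0 ≤ C' * (-B * u ^ 2 + (A - E) * (u * v) + C' * v ^ 2) := by
      nlinarith [sq_nonneg ((A - E) * u + 2 * C' * v), mul_le_mul_of_nonneg_right hq (sq_nonneg u)]
    have h2 : 0 ≤ -B * (-B * u ^ 2 + (A - E) * (u * v) + C' * v ^ 2) := by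
      nlinarith [sq_nonneg (-2 * B * u + (A - E) * v), mul_le_mul_of_nonneg_right hq (sq_nonneg v)]
    linarith
  have hz : ∀ l ∈ Finset.range n, b l * ((C' - B) * (-B * transferMatrix a b x l 0 0 ^ 2 +
      (A - E) * (transferMatrix a b x l 0 0 * transferMatrix a b x l 0 1) +
        C' * transferMatrix a b x l 0 1 ^ 2)) = 0 := by
    rw [← Finset.sum_eq_zero_iff_of_nonneg fun l _ ↦ mul_nonneg (hb l).le (key _ _)]
    rw [← mul_zero (C' - B), ← h, Finset.mul_sum]
    exact Finset.sum_congr rfl fun l _ ↦ by ring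
  -- A sum of terms of one sign vanishes, so each term does. The first two are the form at `(1, 0)`
  -- and at a point whose second coordinate is `a 0 ≠ 0`; this needs `n ≥ 2`.
  have h0 := hz 0 (Finset.mem_range.2 (by omega))
  have h1 := hz 1 (Finset.mem_range.2 (by omega))
  simp only [mul_eq_zero, (hb _).ne', hs, false_or] at h0 h1
  have hB : B = 0 := by simpa using h0
  subst hB
  have hAE : A - E = 0 := by nlinarith
  have h2 : transferMatrix a b x 1 0 1 = a 0 := by
    rw [transferMatrix_succ_zero, transferMatrix_succ_one]
    simp
  rw [hAE, h2] at h1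
  have := (ha 0).ne'
  refine ⟨rfl, ?_, by linarith⟩
  simpa [this] using h1

theorem eval_derivative_discriminant_eq_zero {x c : ℝ}
    (h : transferMatrix a b x n = c • (1 : Matrix (Fin 2) (Fin 2) ℝ)) :
    (derivative (discriminant a b n)).eval x = 0 := by
  rw [eval_derivative_discriminant, h]
  simp

theorem transferMatrix_entries_of_nonpos (ha : ∀ i, 0 < a i) (hb : ∀ i, 0 < b i) {x : ℝ}
    (hx : x ≤ 0) (k : ℕ) : 1 ≤ transferMatrix a b x k 0 0 ∧ 0 ≤ transferMatrix a b x k 0 1 ∧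
      0 ≤ transferMatrix a b x k 1 0 ∧ 1 ≤ transferMatrix a b x k 1 1 := by
  induction k with
  | zero => simp
  | succ k ih =>
    obtain ⟨h1, h2, h3, h4⟩ := ih
    have h : 0 ≤ -x * b k := mul_nonneg (by linarith) (hb k).le
    have := ha k
    have h3' : 0 ≤ transferMatrix a b x (k + 1) 1 0 := by
      rw [transferMatrix_succ_one, Algebra.algebraMap_self_apply]
      nlinarith
    have h4' : 1 ≤ transferMatrix a b x (k + 1) 1 1 := by
      rw [transferMatrix_succ_one, Algebra.algebraMap_self_apply]
      nlinarith
    refine ⟨?_, ?_, h3', h4'⟩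
    · rw [transferMatrix_succ_zero, Algebra.algebraMap_self_apply]
      nlinarith
    · rw [transferMatrix_succ_zero, Algebra.algebraMap_self_apply]
      nlinarith

/-- For `x ≤ 0` every step matrix has non-negative entries, so the diagonal entries of the product
stay at least `1`. This keeps the roots of `D` positive. -/
theorem two_le_eval_discriminant (ha : ∀ i, 0 < a i) (hb : ∀ i, 0 < b i) {x : ℝ} (hx : x ≤ 0) :
    2 ≤ (discriminant a b n).eval x := by
  have h := transferMatrix_entries_of_nonpos ha hb hx n
  rw [eval_discriminant]
  linarith [h.1, h.2.2.2]

theorem eval_zero_discriminant : (discriminant a b n).eval 0 = 2 := by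
  have h (k : ℕ) : transferMatrix a b (0 : ℝ) k 1 0 = 0 ∧ transferMatrix a b (0 : ℝ) k 0 0 = 1 ∧
      transferMatrix a b (0 : ℝ) k 1 1 = 1 := by
    induction k with
    | zero => simp
    | succ k ih => simp [transferMatrix_succ_zero, transferMatrix_succ_one, ih]
  rw [eval_discriminant, (h n).2.1, (h n).2.2]
  norm_num

/-- The parameter multiplies only the upper entry. That entry starts at `0` in the second column,
whose degree therefore lags by one. -/
theorem transferMatrix_natDegree (k : ℕ) :
    (transferMatrix a b (X : ℝ[X]) k 0 0).natDegree ≤ k ∧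
    (transferMatrix a b (X : ℝ[X]) k 1 0).natDegree ≤ k ∧
    (transferMatrix a b (X : ℝ[X]) k 0 1).natDegree ≤ k - 1 ∧
    (transferMatrix a b (X : ℝ[X]) k 1 1).natDegree ≤ k - 1 ∧
    (transferMatrix a b (X : ℝ[X]) k 0 0).coeff k =
      ∏ i ∈ Finset.range k, -(a i * b i) := by
  induction k with
  | zero => simp
  | succ k ih =>
    obtain ⟨h1, h2, h3, h4, h5⟩ := ih
    have hX (c : ℝ) (p : ℝ[X]) (d : ℕ) (hp : p.natDegree ≤ d) :
        (X * C c * p).natDegree ≤ d + 1 := by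
      rw [mul_assoc]
      refine (natDegree_mul_le.trans (add_le_add natDegree_X_le
        ((natDegree_C_mul_le _ _).trans hp))).trans (by omega)
    have h2' : (transferMatrix a b (X : ℝ[X]) (k + 1) 1 0).natDegree ≤ k + 1 := by
      rw [transferMatrix_succ_one, algebraMap_eq]
      exact natDegree_sub_le_of_le (h2.trans k.le_succ) (hX _ _ _ h1) |>.trans (max_self _).le
    have h4' : (transferMatrix a b (X : ℝ[X]) (k + 1) 1 1).natDegree ≤ k := by
      rw [transferMatrix_succ_one, algebraMap_eq]
      rcases k with _ | k
      · simp
      · exact natDegree_sub_le_of_le (h4.trans (Nat.le_succ _)) (hX _ _ _ h3) |>.trans (max_self _).le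
    refine ⟨?_, h2', ?_, h4', ?_⟩
    · rw [transferMatrix_succ_zero, algebraMap_eq]
      exact natDegree_add_le_of_degree_le (h1.trans k.le_succ) ((natDegree_C_mul_le _ _).trans h2')
    · rw [transferMatrix_succ_zero, algebraMap_eq]
      exact natDegree_add_le_of_degree_le (h3.trans (k.sub_le 1)) ((natDegree_C_mul_le _ _).trans h4')
    · rw [transferMatrix_succ_zero, transferMatrix_succ_one, algebraMap_eq, coeff_add, coeff_C_mul,
        coeff_sub, mul_assoc, coeff_X_mul, coeff_C_mul, h5,
        coeff_eq_zero_of_natDegree_lt (Nat.lt_succ_of_le h1),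
        coeff_eq_zero_of_natDegree_lt (Nat.lt_succ_of_le h2),
        Finset.prod_range_succ]
      ring

theorem coeff_discriminant (hn : 2 ≤ n) :
    (discriminant a b n).coeff n = ∏ i ∈ Finset.range n, -(a i * b i) := by
  obtain ⟨-, -, -, h4, h5⟩ := transferMatrix_natDegree (a := a) (b := b) n
  rw [discriminant, Matrix.trace_fin_two, coeff_add, h5,
    coeff_eq_zero_of_natDegree_lt (show _ < n by omega), add_zero]

theorem coeff_discriminant_pos (hn : 2 ≤ n) (ha : ∀ i, 0 < a i) (hb : ∀ i, 0 < b i) :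
    0 < (-1) ^ n * (discriminant a b n).coeff n := by
  rw [coeff_discriminant hn, Finset.prod_neg, Finset.card_range, ← mul_assoc, ← mul_pow]
  simpa using Finset.prod_pos fun i _ ↦ mul_pos (ha i) (hb i)

theorem natDegree_discriminant (hn : 2 ≤ n) (ha : ∀ i, 0 < a i) (hb : ∀ i, 0 < b i) :
    (discriminant a b n).natDegree = n := by
  obtain ⟨h1, -, -, h4, -⟩ := transferMatrix_natDegree (a := a) (b := b) n
  refine natDegree_eq_of_le_of_coeff_ne_zero ?_
    (right_ne_zero_of_mul (coeff_discriminant_pos hn ha hb).ne')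
  rw [discriminant, Matrix.trace_fin_two]
  exact natDegree_add_le_of_degree_le h1 (h4.trans (n.sub_le 1))

/-- Trace `0` and determinant `1` make `I` an eigenvalue of the monodromy. In the Lagrange identity
between its solution and the conjugate one the boundary terms cancel because `|I| = 1`, leaving `(z
- star z) * ∑ b |r| ^ 2 = 0`. -/
theorem im_eq_zero_of_aeval_discriminant (hn : 2 ≤ n) (ha : ∀ i, 0 < a i) (hb : ∀ i, 0 < b i)
    {z : ℂ} (hz : aeval z (discriminant a b n) = 0) : z.im = 0 := by
  rw [aeval_discriminant] at hz
  have hd := transferMatrix_det_eq (a := a) (b := b) (z := z) n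
  have hdet : (transferMatrix a b z n - Complex.I • (1 : Matrix (Fin 2) (Fin 2) ℂ)).det = 0 := by
    rw [Matrix.det_fin_two]
    simp only [Matrix.sub_apply, Matrix.smul_apply, Matrix.one_apply, smul_eq_mul]
    simp
    linear_combination hd - Complex.I * hz + Complex.I_mul_I
  obtain ⟨v, hv, hMv⟩ := Matrix.exists_mulVec_eq_zero_iff.2 hdet
  rw [Matrix.sub_mulVec, Matrix.smul_mulVec, Matrix.one_mulVec, sub_eq_zero] at hMv
  have hconj (k : ℕ) (i : Fin 2) : (transferMatrix a b (star z) k).mulVec (star v) i =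
      star ((transferMatrix a b z k).mulVec v i) := by
    have h (j : Fin 2) : star (transferMatrix a b z k i j) = transferMatrix a b (star z) k i j :=
      transferMatrix_map (a := a) (b := b) (z := z) Complex.conjAe.toAlgHom k i j
    simp only [Matrix.mulVec, dotProduct, Fin.sum_univ_two, ← h, star_add, star_mul', Pi.star_apply]
  have hl := transferMatrix_lagrange (a := a) (b := b) (z := z) (star z) (star v) v n
  simp only [hconj, hMv, Pi.smul_apply, smul_eq_mul, Pi.star_apply] at hl
  have hs : (z - star z) * ∑ i ∈ Finset.range n, algebraMap ℝ ℂ (b i) *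
      (star ((transferMatrix a b z i).mulVec v 0) * (transferMatrix a b z i).mulVec v 0) = 0 := by
    rw [star_mul', star_mul', show star Complex.I = -Complex.I from Complex.conj_I] at hl
    linear_combination hl + (star (v 0) * v 1 - star (v 1) * v 0) * Complex.I_mul_I
  have hsum : ∑ i ∈ Finset.range n, algebraMap ℝ ℂ (b i) *
      (star ((transferMatrix a b z i).mulVec v 0) * (transferMatrix a b z i).mulVec v 0) =
      ((∑ i ∈ Finset.range n, b i * Complex.normSq ((transferMatrix a b z i).mulVec v 0) : ℝ) :
        ℂ) := by
    push_cast
    refine Finset.sum_congr rfl fun i _ ↦ ?_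
    rw [Complex.normSq_eq_conj_mul_self]
    rfl
  rcases mul_eq_zero.1 hs with h | h
  · rw [sub_eq_zero] at h
    exact Complex.conj_eq_iff_im.1 h.symm
  · exfalso
    rw [hsum, Complex.ofReal_eq_zero, Finset.sum_eq_zero_iff_of_nonneg fun i _ ↦
      mul_nonneg (hb i).le (Complex.normSq_nonneg _)] at h
    -- A solution vanishing at two consecutive places is zero.
    have h0 := h 0 (Finset.mem_range.2 (by omega))
    have h1 := h 1 (Finset.mem_range.2 (by omega))
    simp only [mul_eq_zero, (hb _).ne', false_or, Complex.normSq_eq_zero] at h0 h1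
    have hv0 : v 0 = 0 := by simpa using h0
    have h2 : transferMatrix a b z 1 0 1 = a 0 := by
      rw [transferMatrix_succ_zero, transferMatrix_succ_one]
      simp
    simp only [Matrix.mulVec, dotProduct, Fin.sum_univ_two, hv0, mul_zero, zero_add, h2,
      mul_eq_zero, Complex.ofReal_eq_zero, (ha 0).ne', false_or] at h1
    exact hv (by ext i; fin_cases i <;> simp [hv0, h1])

end Discriminant

/-! ### Bands of a polynomial and the eigenvalue functions -/

/-- `ξ 0 = 0, ξ 1, …, ξ n` cut `[0, ∞)` into intervals on each of which `p` is strictly monotone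
and takes all values between `-2` and `2`, starting with `2` at `0`. -/
structure IsBandPartition (p : ℝ[X]) (n : ℕ) (ξ : ℕ → ℝ) : Prop where
  zero : ξ 0 = 0
  lt_succ : ∀ j < n, ξ j < ξ (j + 1)
  two_le : ∀ j ≤ n, 2 ≤ (-1) ^ j * p.eval (ξ j)
  derivative_eq_zero : ∀ j, 0 < j → j < n → (derivative p).eval (ξ j) = 0
  derivative_neg : ∀ j < n, ∀ x ∈ Set.Ioo (ξ j) (ξ (j + 1)), (-1) ^ j * (derivative p).eval x < 0

theorem Polynomial.eval_eq_leadingCoeff_mul_prod_of_card {p : ℝ[X]} {n : ℕ} (hp : p.natDegree ≤ n)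
    (hp0 : p ≠ 0) (s : Finset ℝ) (hs : s.card = n) (hr : ∀ x ∈ s, p.eval x = 0) (x : ℝ) :
    p.eval x = p.leadingCoeff * ∏ y ∈ s, (x - y) := by
  have h1 : s.val ≤ p.roots := (Multiset.le_iff_subset s.nodup).2 fun y hy ↦
    (mem_roots hp0).2 (hr y hy)
  have h2 : s.val = p.roots := Multiset.eq_of_le_of_card_le h1
    ((card_roots' p).trans (hp.trans hs.ge))
  have h3 : p.roots.card = p.natDegree := le_antisymm (card_roots' p) (by
    rw [← h2]
    exact hp.trans hs.ge)
  conv_lhs => rw [← C_leadingCoeff_mul_prod_multiset_X_sub_C h3, ← h2]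
  rw [eval_mul, eval_C, eval_multiset_prod, Multiset.map_map]
  simp

/-- Rolle gives a critical point between consecutive roots; these `n - 1` points are all the roots
of the derivative, which fixes its sign on each band. -/
theorem exists_isBandPartition {p : ℝ[X]} {n : ℕ} (hn : 1 ≤ n) (hdeg : p.natDegree = n)
    (hlc : 0 < (-1) ^ n * p.coeff n) (hroots : p.roots.toFinset.card = n)
    (hpos : ∀ x ∈ p.roots, 0 < x) (h0 : p.eval 0 = 2)
    (hcrit : ∀ x, (derivative p).eval x = 0 → 2 ≤ |p.eval x|) :
    ∃ ξ, IsBandPartition p n ξ := by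
  have hp0 : p ≠ 0 := fun h ↦ by simp [h] at h0
  obtain ⟨ρ, hρ, hρlt⟩ : ∃ ρ : ℕ → ℝ, (∀ j < n, ρ j ∈ p.roots) ∧
      ∀ j, j + 1 < n → ρ j < ρ (j + 1) := by
    refine ⟨fun j ↦ if h : j < n then p.roots.toFinset.orderEmbOfFin hroots ⟨j, h⟩ else 0, ?_, ?_⟩
    · intro j hj
      simp only [hj, dif_pos]
      exact Multiset.mem_toFinset.1 (Finset.orderEmbOfFin_mem _ _ _)
    · intro j hj
      simp only [hj, (Nat.lt_succ_self j).trans hj, dif_pos]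
      exact (Finset.orderEmbOfFin _ hroots).strictMono (Nat.lt_succ_self j)
  have hev (j : ℕ) (hj : j < n) : p.eval (ρ j) = 0 := (mem_roots hp0).1 (hρ j hj)
  have htop : Filter.Tendsto (fun x ↦ (C ((-1) ^ n) * p).eval x) Filter.atTop Filter.atTop := by
    apply tendsto_atTop_of_leadingCoeff_nonneg
    · rw [degree_C_mul (by simp), degree_eq_natDegree hp0, hdeg]
      exact_mod_cast hn
    · rw [leadingCoeff_mul, leadingCoeff_C, leadingCoeff, hdeg]
      exact hlc.le
  -- The inner cut points come from Rolle. The last one is any point beyond the largest root where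
  -- `|p|` has reached `2`; the value `0` past `n` is never used.
  have hex : ∀ j, ∃ x, (j = 0 → x = 0) ∧ (0 < j → j < n → ρ (j - 1) < x ∧ x < ρ j ∧
      (derivative p).eval x = 0) ∧ (j = n → ρ (n - 1) < x ∧ 2 ≤ (-1) ^ n * p.eval x) := by
    intro j
    rcases Nat.eq_zero_or_pos j with rfl | hj
    · exact ⟨0, fun _ ↦ rfl, by omega, by omega⟩
    rcases lt_trichotomy j n with hjn | rfl | hjn
    · have hl := hρlt (j - 1) (by omega)
      rw [Nat.sub_add_cancel hj] at hl
      obtain ⟨c, hc, hc'⟩ := exists_deriv_eq_zero hl p.continuous.continuousOn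
        (by rw [hev _ (by omega), hev _ hjn])
      rw [Polynomial.deriv] at hc'
      exact ⟨c, by omega, fun _ _ ↦ ⟨hc.1, hc.2, hc'⟩, by omega⟩
    · obtain ⟨x, hx1, hx2⟩ := ((htop.eventually_ge_atTop 2).and
        (Filter.eventually_gt_atTop (ρ (j - 1)))).exists
      refine ⟨x, by omega, by omega, fun _ ↦ ⟨hx2, by simpa using hx1⟩⟩
    · exact ⟨0, by omega, by omega, by omega⟩
  choose ξ hξ0 hξ hξn using hex
  have hbelow (j : ℕ) (hj : j < n) : ξ j < ρ j := by
    rcases Nat.eq_zero_or_pos j with rfl | hj0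
    · rw [hξ0 0 rfl]
      exact hpos _ (hρ 0 hj)
    · exact (hξ j hj0 hj).2.1
  have habove (j : ℕ) (hj : j < n) : ρ j < ξ (j + 1) := by
    rcases (Nat.succ_le_of_lt hj).lt_or_eq with h | h
    · exact (hξ (j + 1) j.succ_pos h).1
    · have := (hξn (j + 1) h).1
      rwa [← h, Nat.succ_sub_one] at this
  have hlt (j : ℕ) (hj : j < n) : ξ j < ξ (j + 1) := (hbelow j hj).trans (habove j hj)
  have hmono : StrictMonoOn ξ (Set.Iic n) := strictMonoOn_of_lt_succ Set.ordConnected_Iic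
    fun j _ _ hj ↦ hlt j (Nat.lt_of_succ_le hj)
  have hd0 : (derivative p).coeff (n - 1) = p.coeff n * n := by
    rw [coeff_derivative, Nat.sub_add_cancel hn]
    push_cast [hn]
    ring
  have hcn : p.coeff n ≠ 0 := right_ne_zero_of_mul hlc.ne'
  have hdd : (derivative p).natDegree = n - 1 := by
    refine natDegree_eq_of_le_of_coeff_ne_zero ((natDegree_derivative_le p).trans_eq (by rw [hdeg]))
      ?_
    rw [hd0]
    exact mul_ne_zero hcn (by positivity)
  have hdne : derivative p ≠ 0 := fun h ↦ by
    rw [h, coeff_zero] at hd0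
    exact mul_ne_zero hcn (by positivity) hd0.symm
  have hinj : Set.InjOn ξ (Finset.Ico 1 n) := hmono.injOn.mono fun j hj ↦ by
    have := (Finset.mem_Ico.1 hj).2
    simp only [Set.mem_Iic]
    omega
  have hfac (x : ℝ) : (derivative p).eval x = p.coeff n * n * ∏ j ∈ Finset.Ico 1 n, (x - ξ j) := by
    rw [Polynomial.eval_eq_leadingCoeff_mul_prod_of_card hdd.le hdne ((Finset.Ico 1 n).image ξ),
      leadingCoeff, hdd, hd0, Finset.prod_image hinj]
    · rw [Finset.card_image_of_injOn hinj, Nat.card_Ico]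
    · intro y hy
      obtain ⟨j, hj, rfl⟩ := Finset.mem_image.1 hy
      rw [Finset.mem_Ico] at hj
      exact (hξ j hj.1 hj.2).2.2
  have hneg : ∀ j < n, ∀ x ∈ Set.Ioo (ξ j) (ξ (j + 1)), (-1) ^ j * (derivative p).eval x < 0 := by
    intro j hj x hx
    rw [hfac, ← Finset.prod_Ico_consecutive _ (Nat.succ_le_succ j.zero_le) (Nat.succ_le_of_lt hj)]
    have h1 : 0 < ∏ i ∈ Finset.Ico 1 (j + 1), (x - ξ i) := Finset.prod_pos fun i hi ↦ by
      rw [Finset.mem_Ico] at hi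
      have : ξ i ≤ ξ j := hmono.monotoneOn (Set.mem_Iic.2 (by omega)) (Set.mem_Iic.2 (by omega)) (by omega)
      linarith [hx.1]
    have h2 : 0 < ∏ i ∈ Finset.Ico (j + 1) n, (ξ i - x) := Finset.prod_pos fun i hi ↦ by
      rw [Finset.mem_Ico] at hi
      have : ξ (j + 1) ≤ ξ i := hmono.monotoneOn (Set.mem_Iic.2 (by omega)) (Set.mem_Iic.2 (by omega)) (by omega)
      linarith [hx.2]
    have h3 : ∏ i ∈ Finset.Ico (j + 1) n, (x - ξ i) =
        (-1) ^ (n - (j + 1)) * ∏ i ∈ Finset.Ico (j + 1) n, (ξ i - x) := by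
      rw [← Nat.card_Ico, ← Finset.prod_neg]
      simp
    have h4 : (-1 : ℝ) ^ n = -((-1) ^ j * (-1) ^ (n - (j + 1))) := by
      have e : n = j + (n - (j + 1)) + 1 := by omega
      conv_lhs => rw [e, pow_succ, pow_add]
      ring
    have h5 : 0 < ((-1) ^ n * p.coeff n) * n * ((∏ i ∈ Finset.Ico 1 (j + 1), (x - ξ i)) *
        ∏ i ∈ Finset.Ico (j + 1) n, (ξ i - x)) := by positivity
    rw [h3]
    rw [h4] at h5
    linear_combination h5
  refine ⟨ξ, hξ0 0 rfl, hlt, ?_, fun j hj hjn ↦ (hξ j hj hjn).2.2, hneg⟩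
  intro j hj
  rcases Nat.eq_zero_or_pos j with rfl | hj0
  · simp [hξ0 0 rfl, h0]
  rcases hj.lt_or_eq with hjn | rfl
  · obtain ⟨i, rfl⟩ := Nat.exists_eq_succ_of_ne_zero hj0.ne'
    -- The band to the left contains a root in its interior, so monotonicity gives the sign at its
    -- right end; `hcrit` gives the size.
    have hanti : StrictAntiOn (fun x ↦ (-1) ^ i * p.eval x) (Set.Icc (ξ i) (ξ (i + 1))) := by
      refine strictAntiOn_of_deriv_neg (convex_Icc _ _) (by fun_prop) fun x hx ↦ ?_
      rw [interior_Icc] at hx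
      rw [deriv_const_mul _ p.differentiableAt, Polynomial.deriv]
      exact hneg i (by omega) x hx
    have h1 := hanti ⟨(hbelow i (by omega)).le, (habove i (by omega)).le⟩
      ⟨(hlt i (by omega)).le, le_rfl⟩ (habove i (by omega))
    simp only [hev i (by omega), mul_zero] at h1
    have h2 := hcrit _ (hξ (i + 1) hj0 hjn).2.2
    have h3 : |p.eval (ξ (i + 1))| = |(-1) ^ (i + 1) * p.eval (ξ (i + 1))| := by
      rw [abs_mul, abs_pow, abs_neg, abs_one, one_pow, one_mul]
    rwa [h3, abs_of_pos (by rw [pow_succ]; linarith)] at h2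
  · exact (hξn j rfl).2

namespace IsBandPartition

variable {p : ℝ[X]} {n : ℕ} {ξ : ℕ → ℝ}

theorem strictAntiOn (h : IsBandPartition p n ξ) {j : ℕ} (hj : j < n) :
    StrictAntiOn (fun x ↦ (-1) ^ j * p.eval x) (Set.Icc (ξ j) (ξ (j + 1))) := by
  refine strictAntiOn_of_deriv_neg (convex_Icc _ _) (by fun_prop) fun x hx ↦ ?_
  rw [interior_Icc] at hx
  rw [deriv_const_mul _ p.differentiableAt, Polynomial.deriv]
  exact h.derivative_neg j hj x hx

theorem monotoneOn (h : IsBandPartition p n ξ) : MonotoneOn ξ (Set.Iic n) :=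
  (strictMonoOn_of_lt_succ Set.ordConnected_Iic
    fun j _ _ hj ↦ h.lt_succ j (Nat.lt_of_succ_le hj)).monotoneOn

theorem exists_band_function (h : IsBandPartition p n ξ) : ∃ g : ℕ → ℚ → ℝ, ∀ j < n, ∀ q : ℚ,
    j ≤ q → q ≤ j + 1 → g j q ∈ Set.Icc (ξ j) (ξ (j + 1)) ∧
      p.eval (g j q) = 2 * Real.cos (Real.pi * q) := by
  have key : ∀ (j : ℕ) (q : ℚ), ∃ x, j < n → x ∈ Set.Icc (ξ j) (ξ (j + 1)) ∧
      p.eval x = 2 * Real.cos (Real.pi * q) := by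
    intro j q
    by_cases hj : j < n
    · have h1 := h.two_le j hj.le
      have h2 := h.two_le (j + 1) hj
      rw [pow_succ] at h2
      have hs : ((-1 : ℝ) ^ j) * (-1) ^ j = 1 := by
        rw [← mul_pow]
        simp
      have hc : |(-1) ^ j * (2 * Real.cos (Real.pi * q))| ≤ 2 := by
        rw [abs_mul, abs_pow, abs_neg, abs_one, one_pow, one_mul, abs_mul, abs_two]
        linarith [Real.abs_cos_le_one (Real.pi * q)]
      rw [abs_le] at hc
      obtain ⟨x, hx, hxe⟩ := intermediate_value_Icc' (h.lt_succ j hj).le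
        (f := fun x ↦ (-1) ^ j * p.eval x) (by fun_prop)
        (show (-1) ^ j * (2 * Real.cos (Real.pi * q)) ∈ _ from ⟨by linarith, by linarith⟩)
      refine ⟨x, fun _ ↦ ⟨hx, ?_⟩⟩
      exact mul_left_cancel₀ (left_ne_zero_of_mul_eq_one hs) hxe
    · exact ⟨0, fun h ↦ absurd h hj⟩
  choose g hg using key
  exact ⟨g, fun j hj q _ _ ↦ hg j q hj⟩

/-- `l1` solves `p = 2 cos (π q)` in the band ending at or after `q`, `l2` in the band starting at
or before `q`, so they can differ only at interior integers. There `l1 k ≤ ξ k ≤ l2 k`, and equality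
forces the critical point `ξ k`. -/
theorem exists_eigenvalue_functions (h : IsBandPartition p n ξ) (hn : 2 ≤ n) (h0 : p.eval 0 = 2) :
    ∃ l1 l2 : ℚ → ℝ, (l1 0 = 0 ∧ l2 0 = 0) ∧ l1 n = l2 n ∧
      (∀ q : ℚ, 0 ≤ q → q ≤ n → p.eval (l1 q) = 2 * Real.cos (Real.pi * q) ∧
        p.eval (l2 q) = 2 * Real.cos (Real.pi * q) ∧ l1 q ≤ l2 q) ∧
      (∀ q r : ℚ, 0 ≤ q → q < r → r ≤ n → l2 q < l1 r) ∧
      (∀ q : ℚ, 0 ≤ q → q ≤ n → (∀ k : ℕ, q ≠ k) → l1 q = l2 q) ∧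
      (∀ k : ℕ, 0 < k → k < n → l1 k = l2 k → (derivative p).eval (l1 k) = 0) ∧
      (p.eval 1 = -2 → (derivative p).eval 1 = 0 → (∀ x, p.eval x = -2 → 1 ≤ x) →
        l1 1 = 1 ∧ l2 1 = 1) := by
  obtain ⟨g, hg⟩ := h.exists_band_function
  -- Shifting by `j * π` brings the angle into `[0, π]`, where the cosine is strictly decreasing.
  have hval (j : ℕ) (hj : j < n) (q : ℚ) (h1 : j ≤ q) (h2 : q ≤ j + 1) :
      (-1) ^ j * p.eval (g j q) = 2 * Real.cos (Real.pi * q - j * Real.pi) := by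
    rw [(hg j hj q h1 h2).2, Real.cos_sub_nat_mul_pi]
    ring
  have hcos (j : ℕ) (q r : ℚ) (h1 : j ≤ q) (h2 : q < r) (h3 : r ≤ j + 1) :
      Real.cos (Real.pi * r - j * Real.pi) < Real.cos (Real.pi * q - j * Real.pi) := by
    have h1' : (j : ℝ) ≤ q := by exact_mod_cast h1
    have h2' : (q : ℝ) < r := by exact_mod_cast h2
    have h3' : (r : ℝ) ≤ j + 1 := by exact_mod_cast h3
    have := Real.pi_pos
    apply Real.strictAntiOn_cos
    · constructor <;> nlinarith
    · constructor <;> nlinarith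
    · nlinarith
  have hgmono (j : ℕ) (hj : j < n) (q r : ℚ) (h1 : j ≤ q) (h2 : q < r) (h3 : r ≤ j + 1) :
      g j q < g j r := by
    rw [← (h.strictAntiOn hj).lt_iff_gt (hg j hj r (h1.trans h2.le) h3).1
      (hg j hj q h1 (h2.le.trans h3)).1]
    rw [hval j hj q h1 (h2.le.trans h3), hval j hj r (h1.trans h2.le) h3]
    linarith [hcos j q r h1 h2 h3]
  have hgtop (j : ℕ) (hj : j < n) (q : ℚ) (h1 : j ≤ q) (h2 : q < j + 1) : g j q < ξ (j + 1) := by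
    refine lt_of_lt_of_le (hgmono j hj q (j + 1) h1 h2 le_rfl) (hg j hj _ ?_ le_rfl).1.2
    linarith
  have hn0 : 0 < n := by omega
  have huniq (j : ℕ) (hj : j < n) (x y : ℝ) (hx : x ∈ Set.Icc (ξ j) (ξ (j + 1)))
      (hy : y ∈ Set.Icc (ξ j) (ξ (j + 1))) (hxy : p.eval x = p.eval y) : x = y :=
    (h.strictAntiOn hj).injOn hx hy (by simp [hxy])
  have hlow (q : ℚ) (hq0 : 0 ≤ q) (hq : q ≤ n) : ⌈q⌉₊ - 1 < n ∧ ((⌈q⌉₊ - 1 : ℕ) : ℚ) ≤ q ∧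
      q ≤ ((⌈q⌉₊ - 1 : ℕ) : ℚ) + 1 := by
    have h1 : ⌈q⌉₊ ≤ n := Nat.ceil_le.2 hq
    rcases hq0.eq_or_lt with rfl | hq0
    · simp [hn0]
    have h2 : 0 < ⌈q⌉₊ := Nat.ceil_pos.2 hq0
    refine ⟨by omega, ?_, ?_⟩
    · exact (Nat.lt_ceil.1 (by omega)).le
    · rw [← Nat.cast_add_one, Nat.sub_add_cancel h2]
      exact Nat.le_ceil q
  have hupp (q : ℚ) (hq0 : 0 ≤ q) (hq : q ≤ n) : min ⌊q⌋₊ (n - 1) < n ∧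
      ((min ⌊q⌋₊ (n - 1) : ℕ) : ℚ) ≤ q ∧ q ≤ ((min ⌊q⌋₊ (n - 1) : ℕ) : ℚ) + 1 := by
    refine ⟨by omega, le_trans (by exact_mod_cast min_le_left _ _) (Nat.floor_le hq0), ?_⟩
    rcases min_choice ⌊q⌋₊ (n - 1) with h | h <;> rw [h]
    · exact (Nat.lt_floor_add_one q).le
    · rw [← Nat.cast_add_one, Nat.sub_add_cancel hn0]
      exact hq
  have hnat (k : ℕ) (hk : 0 < k) (hkn : k < n) :
      g (⌈(k : ℚ)⌉₊ - 1) k ≤ ξ k ∧ ξ k ≤ g (min ⌊(k : ℚ)⌋₊ (n - 1)) k := by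
    obtain ⟨a1, a2, a3⟩ := hlow k (Nat.cast_nonneg k) (by exact_mod_cast hkn.le)
    obtain ⟨b1, b2, b3⟩ := hupp k (Nat.cast_nonneg k) (by exact_mod_cast hkn.le)
    have ha := (hg _ a1 _ a2 a3).1.2
    have hb := (hg _ b1 _ b2 b3).1.1
    rw [Nat.ceil_natCast] at ha ⊢
    rw [Nat.floor_natCast, min_eq_left (by omega)] at hb ⊢
    rw [Nat.sub_add_cancel hk] at ha
    exact ⟨ha, hb⟩
  -- Truncated subtraction at `q = 0` and the cap `n - 1` at `q = n` make both functions use the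
  -- only band available at the two ends.
  refine ⟨fun q ↦ g (⌈q⌉₊ - 1) q, fun q ↦ g (min ⌊q⌋₊ (n - 1)) q, ?_, ?_, ?_, ?_, ?_, ?_, ?_⟩
  · have : g 0 0 = 0 := by
      have h1 := hg 0 hn0 0 (by simp) (by simp)
      refine huniq 0 hn0 _ _ h1.1 ⟨h.zero.le, ?_⟩ (by simp [h1.2, h0])
      rw [← h.zero]
      exact (h.lt_succ 0 hn0).le
    simp [this]
  · simp
  · intro q hq0 hq
    obtain ⟨a1, a2, a3⟩ := hlow q hq0 hq
    obtain ⟨b1, b2, b3⟩ := hupp q hq0 hq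
    refine ⟨(hg _ a1 _ a2 a3).2, (hg _ b1 _ b2 b3).2, ?_⟩
    have hle : ⌈q⌉₊ - 1 ≤ min ⌊q⌋₊ (n - 1) :=
      le_min (by have := Nat.ceil_le_floor_add_one q; omega) (by omega)
    rcases hle.eq_or_lt with he | hl
    · simp only
      rw [he]
    · exact (hg _ a1 _ a2 a3).1.2.trans ((h.monotoneOn (Set.mem_Iic.2 (by omega)) (Set.mem_Iic.2 (by omega))
        (by omega)).trans (hg _ b1 _ b2 b3).1.1)
  · intro q r hq0 hqr hr
    have hq : q < n := hqr.trans_le hr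
    have hfl : ⌊q⌋₊ < n := (Nat.floor_lt hq0).2 hq
    have e : min ⌊q⌋₊ (n - 1) = ⌊q⌋₊ := min_eq_left (by omega)
    simp only [e]
    obtain ⟨a1, a2, a3⟩ := hlow r (hq0.trans hqr.le) hr
    have h1 : ⌊q⌋₊ < ⌈r⌉₊ := Nat.lt_ceil.2 ((Nat.floor_le hq0).trans_lt hqr)
    rcases (Nat.le_sub_one_of_lt h1).eq_or_lt with he | hl
    · rw [← he] at a1 a2 a3 ⊢
      exact hgmono _ hfl q r (Nat.floor_le hq0) hqr a3
    · refine (hgtop _ hfl q (Nat.floor_le hq0) (Nat.lt_floor_add_one q)).trans_le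
        ((h.monotoneOn (Set.mem_Iic.2 (by omega)) (Set.mem_Iic.2 (by omega)) (by omega)).trans (hg _ a1 _ a2 a3).1.1)
  · intro q hq0 hq hk
    have hq' : q < n := lt_of_le_of_ne hq (hk n)
    have hfl : ⌊q⌋₊ < n := (Nat.floor_lt hq0).2 hq'
    have h1 : ⌊q⌋₊ < ⌈q⌉₊ := Nat.lt_ceil.2 (lt_of_le_of_ne (Nat.floor_le hq0) (hk _).symm)
    have h2 := Nat.ceil_le_floor_add_one q
    have e : ⌈q⌉₊ - 1 = min ⌊q⌋₊ (n - 1) := by omega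
    simp only [e]
  · intro k hk hkn he
    have h1 := hnat k hk hkn
    have h2 : g (⌈(k : ℚ)⌉₊ - 1) k = ξ k := le_antisymm h1.1 (h1.2.trans he.ge)
    simp only
    rw [h2]
    exact h.derivative_eq_zero k hk hkn
  · intro e1 e2 e3
    have h1 := hg 0 hn0 1 (by simp) (by simp)
    have h2 := hg 1 (by omega) 1 (by simp) (by norm_num)
    have hv : (2 * Real.cos (Real.pi * (1 : ℚ)) : ℝ) = -2 := by simp
    rw [hv] at h1 h2
    have hge := e3 _ h1.2
    have hz := h.zero
    have hl1 : g 0 1 = 1 := huniq 0 hn0 _ _ h1.1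
      ⟨by linarith, hge.trans h1.1.2⟩ (h1.2.trans e1.symm)
    -- Inside a band the derivative does not vanish, so the critical point `1` must be the right end
    -- of band `0`.
    have hξ1 : ξ 1 = 1 := by
      refine le_antisymm (not_lt.1 fun hlt ↦ ?_) (hl1 ▸ h1.1.2)
      have := h.derivative_neg 0 hn0 1 ⟨by linarith, hlt⟩
      rw [e2, mul_zero] at this
      exact lt_irrefl _ this
    have hl2 : g 1 1 = 1 := huniq 1 (by omega) _ _ h2.1
      ⟨hξ1.le, hξ1 ▸ (h.lt_succ 1 (by omega)).le⟩ (h2.2.trans e1.symm)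
    have e : min 1 (n - 1) = 1 := by omega
    simp [e, hl1, hl2]

end IsBandPartition

/-- If `|D| < 2` and `D' = 0`, the monodromy is scalar of determinant `1`, so `D = ±2`, a
contradiction. In particular the roots of `D`, all real, are simple. -/
theorem exists_isBandPartition_discriminant {a b : ℕ → ℝ} {n : ℕ} (hn : 2 ≤ n) (ha : ∀ i, 0 < a i)
    (hb : ∀ i, 0 < b i) : ∃ ξ, IsBandPartition (discriminant a b n) n ξ := by
  have hdeg := natDegree_discriminant hn ha hb
  have hcrit (x : ℝ) (hx : (derivative (discriminant a b n)).eval x = 0) :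
      2 ≤ |(discriminant a b n).eval x| := by
    by_contra! hlt
    obtain ⟨h1, h2, h3⟩ := transferMatrix_eq_of_derivative_eq_zero hn ha hb hlt.le hx
    have hd := transferMatrix_det_eq (a := a) (b := b) (z := x) n
    rw [eval_discriminant, h3, abs_lt] at hlt
    rw [h1, h3] at hd
    nlinarith
  have hp0 : discriminant a b n ≠ 0 := fun h ↦ by
    rw [h, natDegree_zero] at hdeg
    omega
  have hsplit : (discriminant a b n).Splits := by
    refine Splits.of_splits_map (algebraMap ℝ ℂ) (IsAlgClosed.splits _) fun z hz ↦ ?_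
    have h1 := (mem_roots'.1 hz).2
    rw [IsRoot.def, eval_map_algebraMap] at h1
    exact ⟨z.re, Complex.ext rfl (by simp [im_eq_zero_of_aeval_discriminant hn ha hb h1])⟩
  have hnodup : (discriminant a b n).roots.Nodup := by
    rw [Multiset.nodup_iff_count_le_one]
    intro x
    rw [count_roots]
    by_contra! hx
    obtain ⟨h1, h2⟩ := (one_lt_rootMultiplicity_iff_isRoot hp0).1 hx
    have h3 := hcrit x h2
    rw [h1] at h3
    norm_num at h3
  refine exists_isBandPartition (by omega) hdeg (coeff_discriminant_pos hn ha hb) ?_ ?_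
    eval_zero_discriminant hcrit
  · rw [Multiset.toFinset_card_of_nodup hnodup, ← hsplit.natDegree_eq_card_roots, hdeg]
  · intro x hx
    by_contra! h
    have h1 := two_le_eval_discriminant (n := n) ha hb h
    rw [(mem_roots hp0).1 hx] at h1
    norm_num at h1

/-! ### The eigenvalue `1` is the lowest antiperiodic one -/

/-- If the Dirichlet solution is positive inside the period, then so is the Dirichlet form. -/
theorem dirichlet_form_nonneg {a b u q z t : ℕ → ℝ} {n : ℕ} (hn : 2 ≤ n) (ha : ∀ i, 0 < a i)
    (hu : ∀ i, u (i + 1) = u i + a i * q (i + 1)) (hu0 : u 0 = 0) (hun : u n = 0)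
    (hz : ∀ i, z (i + 1) = z i + a i * t (i + 1)) (ht : ∀ i, t (i + 1) = t i - b i * z i)
    (hz0 : z 0 = 0) (hzn : z n = 0) (hpos : ∀ i, 0 < i → i < n → 0 < z i) :
    0 ≤ ∑ i ∈ Finset.range n, (a i * q (i + 1) ^ 2 - b i * u i ^ 2) := by
  -- Riccati substitution `t / z`: each step of the bound loses exactly the square in `e7` (a
  -- discrete Picone identity).
  have key : ∀ k, k + 1 < n → t (k + 1) * u (k + 1) ^ 2 / z (k + 1) ≤
      ∑ i ∈ Finset.range (k + 1), (a i * q (i + 1) ^ 2 - b i * u i ^ 2) := by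
    intro k
    induction k with
    | zero =>
      intro h1
      have hz1 := hpos 1 one_pos h1
      have e1 := hu 0
      have e2 := hz 0
      rw [hu0, zero_add, zero_add] at e1
      rw [hz0, zero_add, zero_add] at e2
      rw [zero_add, Finset.sum_range_one, hu0, div_le_iff₀ hz1, e1, e2, zero_add]
      apply le_of_eq
      ring
    | succ k ih =>
      intro h1
      have hz1 := hpos (k + 1) k.succ_pos (by omega)
      have hz2 := hpos (k + 2) (by omega) h1
      have h2 := ih (by omega)
      rw [Finset.sum_range_succ]
      have ha' := ha (k + 1)
      have e1 := hu (k + 1)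
      have e2 := hz (k + 1)
      have e3 := ht (k + 1)
      simp only [show k + 1 + 1 = k + 2 from rfl] at *
      generalize z (k + 1) = Z at *
      generalize z (k + 2) = Z' at *
      generalize u (k + 1) = x at *
      generalize u (k + 2) = y at *
      generalize q (k + 2) = p at *
      have h3 : t (k + 2) * y ^ 2 / Z' ≤ t (k + 1) * x ^ 2 / Z + (a (k + 1) * p ^ 2 -
          b (k + 1) * x ^ 2) := by
        have e4 : t (k + 1) * x ^ 2 / Z = t (k + 2) * x ^ 2 / Z + b (k + 1) * x ^ 2 := by
          rw [e3]
          field_simp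
          ring
        have e5 : p = (y - x) / a (k + 1) := by
          rw [e1]
          field_simp
          ring
        have e6 : t (k + 2) = (Z' - Z) / a (k + 1) := by
          rw [e2]
          field_simp
          ring
        have e7 : a (k + 1) * p ^ 2 + t (k + 2) * x ^ 2 / Z - t (k + 2) * y ^ 2 / Z' =
            (Z' * x - Z * y) ^ 2 / (a (k + 1) * Z * Z') := by
          rw [e5, e6]
          field_simp
          ring
        have e8 : 0 ≤ (Z' * x - Z * y) ^ 2 / (a (k + 1) * Z * Z') := by positivity
        linarith
      linarith
  -- The last step is separate because `z n = 0` cannot be a denominator; there `u n = z n = 0`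
  -- gives exact cancellation.
  obtain ⟨k, rfl⟩ : ∃ k, n = k + 2 := ⟨n - 2, by omega⟩
  have h2 := key k (by omega)
  have hz1 := hpos (k + 1) k.succ_pos (by omega)
  have ha' := ha (k + 1)
  rw [Finset.sum_range_succ]
  have e1 := hu (k + 1)
  have e2 := hz (k + 1)
  have e3 := ht (k + 1)
  simp only [show k + 1 + 1 = k + 2 from rfl] at *
  rw [hun] at e1
  rw [hzn] at e2
  have e5 : q (k + 2) = -u (k + 1) / a (k + 1) := by
    field_simp
    linarith
  have e6 : t (k + 1) = b (k + 1) * z (k + 1) - z (k + 1) / a (k + 1) := by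
    field_simp
    rw [e3] at e2
    linarith
  rw [e5]
  rw [e6] at h2
  have e7 : (b (k + 1) * z (k + 1) - z (k + 1) / a (k + 1)) * u (k + 1) ^ 2 / z (k + 1) =
      b (k + 1) * u (k + 1) ^ 2 - a (k + 1) * (-u (k + 1) / a (k + 1)) ^ 2 := by
    field_simp
  linarith

/-- If `1` is an antiperiodic eigenvalue whose Dirichlet solution is positive inside the period,
then no antiperiodic eigenvalue is smaller. -/
theorem one_le_of_antiperiodic {a b : ℕ → ℝ} {n : ℕ} (hn : 2 ≤ n) (ha : ∀ i, 0 < a i)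
    (hb : ∀ i, 0 < b i) (h1 : transferMatrix a b (1 : ℝ) n = -1)
    (hpos : ∀ i, 0 < i → i < n → 0 < transferMatrix a b (1 : ℝ) i 0 1) {x : ℝ}
    (hx : (discriminant a b n).eval x = -2) : 1 ≤ x := by
  have hd := transferMatrix_det_eq (a := a) (b := b) (z := x) n
  rw [eval_discriminant] at hx
  have hdet : (transferMatrix a b x n + 1).det = 0 := by
    rw [Matrix.det_fin_two]
    simp
    linear_combination hd + hx
  obtain ⟨v, hv, hMv⟩ := Matrix.exists_mulVec_eq_zero_iff.2 hdet
  rw [Matrix.add_mulVec, Matrix.one_mulVec, add_eq_zero_iff_eq_neg] at hMv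
  by_contra! hlt
  set r : ℕ → ℝ := fun i ↦ (transferMatrix a b x i).mulVec v 0 with hr
  set s : ℕ → ℝ := fun i ↦ (transferMatrix a b x i).mulVec v 1 with hs
  -- Every solution at parameter `1` is antiperiodic; this one agrees with `r` at `0`, so `r - w`
  -- vanishes at both `0` and `n`.
  set w : ℕ → ℝ := fun i ↦ transferMatrix a b (1 : ℝ) i 0 0 * r 0 with hw
  set t : ℕ → ℝ := fun i ↦ transferMatrix a b (1 : ℝ) i 1 0 * r 0 with ht
  have hs1 (i : ℕ) : s (i + 1) = s i - x * b i * r i := by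
    simp [hs, hr, Matrix.mulVec, dotProduct, transferMatrix_succ_one]
    ring
  have hr1 (i : ℕ) : r (i + 1) = r i + a i * s (i + 1) := by
    simp [hs, hr, Matrix.mulVec, dotProduct, transferMatrix_succ_zero]
    ring
  have ht1 (i : ℕ) : t (i + 1) = t i - b i * w i := by
    simp [ht, hw, transferMatrix_succ_one]
    ring
  have hw1 (i : ℕ) : w (i + 1) = w i + a i * t (i + 1) := by
    simp [ht, hw, transferMatrix_succ_zero]
    ring
  have hr0 : r n = -r 0 := by
    simp only [hr, hMv, transferMatrix_zero, Matrix.one_mulVec, Pi.neg_apply]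
  have hs0 : s n = -s 0 := by
    simp only [hs, hMv, transferMatrix_zero, Matrix.one_mulVec, Pi.neg_apply]
  have hw0 : w 0 = r 0 := by simp [hw]
  have ht0 : t 0 = 0 := by simp [ht]
  have hwn : w n = -r 0 := by simp [hw, h1]
  have htn : t n = 0 := by simp [ht, h1]
  have hform := dirichlet_form_nonneg (a := a) (b := b) (u := fun i ↦ r i - w i)
    (q := fun i ↦ s i - t i) (z := fun i ↦ transferMatrix a b (1 : ℝ) i 0 1)
    (t := fun i ↦ transferMatrix a b (1 : ℝ) i 1 1) hn ha
    (fun i ↦ by simp only [hr1, hw1]; ring) (by simp [hw0]) (by simp [hwn, hr0])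
    (fun i ↦ by simp [transferMatrix_succ_zero])
    (fun i ↦ by simp [transferMatrix_succ_one]) (by simp) (by simp [h1]) hpos
  have hsum : ∑ i ∈ Finset.range n, (a i * (s (i + 1) - t (i + 1)) ^ 2 - b i * (r i - w i) ^ 2) =
      (x - 1) * ∑ i ∈ Finset.range n, b i * r i ^ 2 := by
    -- Summation by parts: the quadratic boundary terms at `0` and `n` agree, since a change of sign
    -- does not affect them.
    have h2 := Finset.sum_range_sub (fun i ↦ s i * r i - 2 * (t i * r i) + t i * w i) n
    simp only [hs0, hr0, ht0, htn, zero_mul, mul_zero, neg_mul_neg, sub_self] at h2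
    rw [← sub_eq_zero, Finset.mul_sum, ← Finset.sum_sub_distrib, ← h2]
    refine Finset.sum_congr rfl fun i _ ↦ ?_
    rw [hr1, hw1, hs1, ht1]
    ring
  rw [hsum] at hform
  have hge : 0 ≤ ∑ i ∈ Finset.range n, b i * r i ^ 2 :=
    Finset.sum_nonneg fun i _ ↦ mul_nonneg (hb i).le (sq_nonneg _)
  have hz : ∑ i ∈ Finset.range n, b i * r i ^ 2 = 0 := by nlinarith
  rw [Finset.sum_eq_zero_iff_of_nonneg fun i _ ↦ mul_nonneg (hb i).le (sq_nonneg _)] at hz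
  have z0 := hz 0 (Finset.mem_range.2 (by omega))
  have z1 := hz 1 (Finset.mem_range.2 (by omega))
  simp only [mul_eq_zero, (hb _).ne', false_or, pow_eq_zero_iff two_ne_zero] at z0 z1
  have e1 := hr1 0
  have e2 := hs1 0
  rw [zero_add, z0, z1, zero_add, eq_comm, mul_eq_zero, or_iff_right (ha 0).ne'] at e1
  rw [zero_add, e1, z0, mul_zero, sub_zero] at e2
  refine hv (funext fun i ↦ ?_)
  fin_cases i
  · simpa [hr] using z0
  · simpa [hs] using e2.symm

/-! ### Counting eigenvalues, and powers of unimodular `2 × 2` matrices -/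

section LinearAlgebra

variable {V : Type*} [AddCommGroup V] [Module ℝ V] {T : V →ₗ[ℝ] V} {N : ℕ} {ν : Fin N → ℝ}

/-- Eigenspaces are independent, so vectors chosen separately for each value form an independent
family, a basis by cardinality. Only lower bounds on the eigenspaces are needed. -/
theorem isEigenvalueList_of_card_le (hpos : 0 < N) (hN : Module.finrank ℝ V = N)
    (h : ∀ μ, (Finset.univ.filter fun j ↦ ν j = μ).card ≤
      Module.finrank ℝ (Module.End.eigenspace T μ)) : IsEigenvalueList T ν := by
  have key (μ : ℝ) : ∃ f : {j // ν j = μ} → Module.End.eigenspace T μ, LinearIndependent ℝ f := by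
    have hc : Fintype.card {j // ν j = μ} ≤ Module.finrank ℝ (Module.End.eigenspace T μ) := by
      rw [Fintype.card_subtype]
      exact h μ
    obtain ⟨f, hf⟩ := exists_linearIndependent_of_le_finrank hc
    exact ⟨f ∘ Fintype.equivFin _, hf.comp _ (Fintype.equivFin _).injective⟩
  choose f hf using key
  have hspan (μ : ℝ) : Submodule.span ℝ (Set.range fun j ↦ (f μ j : V)) ≤
      Module.End.eigenspace T μ := by
    rw [Submodule.span_le]
    rintro _ ⟨j, rfl⟩
    exact (f μ j).2
  have hli : LinearIndependent ℝ fun x : Σ μ, {j // ν j = μ} ↦ (f x.1 x.2 : V) := by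
    refine linearIndependent_iUnion_finite (f := fun μ j ↦ (f μ j : V))
      (fun μ ↦ (hf μ).map' (Submodule.subtype _) (Submodule.ker_subtype _)) fun μ t _ hμ ↦ ?_
    exact ((Module.End.eigenspaces_iSupIndep T).disjoint_biSup hμ).mono (hspan μ)
      (iSup₂_mono fun i _ ↦ hspan i)
  have hli' := hli.comp _ (Equiv.sigmaFiberEquiv ν).symm.injective
  have : Nonempty (Fin N) := ⟨⟨0, hpos⟩⟩
  refine ⟨basisOfLinearIndependentOfCardEqFinrank hli' (by simp [hN]), fun j ↦ ?_⟩
  rw [coe_basisOfLinearIndependentOfCardEqFinrank]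
  exact Module.End.mem_eigenspace_iff.1 (f (ν j) ⟨j, rfl⟩).2

/-- In the basis of eigenvectors `T` is diagonal, so the span of these eigenspaces is spanned by the
basis vectors with value in `S`. -/
theorem IsEigenvalueList.finrank_iSup_eigenspace (h : IsEigenvalueList T ν) (S : Set ℝ)
    {lo hi : ℕ} (hhi : hi ≤ N) (hS : ∀ j : Fin N, ν j ∈ S ↔ lo ≤ j ∧ j < hi) :
    Module.finrank ℝ (⨆ x ∈ S, Module.End.eigenspace T x : Submodule ℝ V) = hi - lo := by
  obtain ⟨b, hb⟩ := h
  have hrepr (v : V) (j : Fin N) : b.repr (T v) j = ν j * b.repr v j := by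
    have : (Finsupp.lapply j ∘ₗ b.repr.toLinearMap ∘ₗ T : V →ₗ[ℝ] ℝ) =
        ν j • (Finsupp.lapply j ∘ₗ b.repr.toLinearMap) := by
      refine b.ext fun i ↦ ?_
      by_cases hij : i = j
      · subst hij
        simp [hb]
      · simp [hb, hij]
    exact LinearMap.congr_fun this v
  have hspan : (⨆ x ∈ S, Module.End.eigenspace T x : Submodule ℝ V) =
      Submodule.span ℝ (b '' {j | ν j ∈ S}) := by
    apply le_antisymm
    · refine iSup₂_le fun x hx v hv ↦ ?_
      rw [b.mem_span_image]
      intro j hj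
      have h1 := hrepr v j
      rw [Module.End.mem_eigenspace_iff.1 hv, map_smul, Finsupp.smul_apply, smul_eq_mul] at h1
      have h2 := mul_right_cancel₀ (Finsupp.mem_support_iff.1 hj) h1
      rw [Set.mem_ofPred_eq, ← h2]
      exact hx
    · rw [Submodule.span_le]
      rintro _ ⟨j, hj, rfl⟩
      exact Submodule.mem_iSup_of_mem _ (Submodule.mem_iSup_of_mem hj
        (Module.End.mem_eigenspace_iff.2 (hb j)))
  classical
  rw [hspan, show b '' {j | ν j ∈ S} = Set.range (b ∘ (Subtype.val : {j // ν j ∈ S} → Fin N)) by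
    rw [Set.image_eq_range]; rfl,
    finrank_span_eq_card (b.linearIndependent.comp _ Subtype.val_injective), Fintype.card_subtype,
    ← Finset.card_map Fin.valEmbedding, ← Nat.card_Ico]
  congr 1
  ext i
  simp only [Finset.mem_map, Finset.mem_filter, Finset.mem_univ, true_and, Fin.valEmbedding_apply,
    Finset.mem_Ico, hS]
  constructor
  · rintro ⟨j, hj, rfl⟩
    exact hj
  · intro hi'
    exact ⟨⟨i, by omega⟩, hi', rfl⟩

/-- Cayley–Hamilton gives the Chebyshev recursion; the factor `sin θ` avoids a division. -/
theorem sin_smul_pow_succ {A : Matrix (Fin 2) (Fin 2) ℝ} {θ : ℝ}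
    (hdet : A 0 0 * A 1 1 - A 0 1 * A 1 0 = 1) (htr : A 0 0 + A 1 1 = 2 * Real.cos θ) (k : ℕ) :
    Real.sin θ • A ^ (k + 1) =
      Real.sin ((k + 1) * θ) • A - Real.sin (k * θ) • (1 : Matrix (Fin 2) (Fin 2) ℝ) := by
  have hA : A * A = (2 * Real.cos θ) • A - (1 : Matrix (Fin 2) (Fin 2) ℝ) := by
    rw [← htr]
    ext i j
    fin_cases i <;> fin_cases j <;> simp [Matrix.mul_apply, Fin.sum_univ_two]
    · linear_combination -hdet
    · ring
    · ring
    · linear_combination -hdet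
  induction k with
  | zero => simp
  | succ k ih =>
    rw [pow_succ, ← Matrix.smul_mul, ih, sub_mul, Matrix.smul_mul, hA, Matrix.smul_mul, one_mul]
    have h1 : Real.sin ((k + 1 + 1) * θ) =
        2 * Real.cos θ * Real.sin ((k + 1) * θ) - Real.sin (k * θ) := by
      have e1 : ((k : ℝ) + 1 + 1) * θ = (k + 1) * θ + θ := by ring
      have e2 : (k : ℝ) * θ = (k + 1) * θ - θ := by ring
      rw [e1, e2, Real.sin_add, Real.sin_sub]
      ring
    push_cast
    rw [h1]
    module

theorem pow_eq_one_of_trace {A : Matrix (Fin 2) (Fin 2) ℝ} {k m : ℕ} (hm : 1 ≤ m) (hk : ¬ m ∣ k)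
    (hdet : A 0 0 * A 1 1 - A 0 1 * A 1 0 = 1)
    (htr : A 0 0 + A 1 1 = 2 * Real.cos (Real.pi * ((k : ℝ) / m))) : A ^ (2 * m) = 1 := by
  have hm' : (m : ℝ) ≠ 0 := by positivity
  have hs : Real.sin (Real.pi * ((k : ℝ) / m)) ≠ 0 := by
    intro h
    obtain ⟨z, hz⟩ := Real.sin_eq_zero_iff.1 h
    have h1 : (z : ℝ) * m = k := by
      field_simp at hz
      exact hz
    have h2 : z * m = k := by exact_mod_cast h1
    exact hk (Int.natCast_dvd_natCast.1 ⟨z, by rw [← h2]; ring⟩)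
  have h := sin_smul_pow_succ hdet htr (2 * m - 1)
  rw [Nat.sub_add_cancel (by omega)] at h
  push_cast [show 1 ≤ 2 * m by omega] at h
  have e1 : ((2 : ℝ) * m - 1 + 1) * (Real.pi * ((k : ℝ) / m)) = k * (2 * Real.pi) - 0 := by
    field_simp
    ring
  have e2 : ((2 : ℝ) * m - 1) * (Real.pi * ((k : ℝ) / m)) =
      k * (2 * Real.pi) - Real.pi * ((k : ℝ) / m) := by
    field_simp
  rw [e1, e2, Real.sin_nat_mul_two_pi_sub, Real.sin_nat_mul_two_pi_sub, Real.sin_zero, neg_zero,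
    zero_smul, zero_sub, neg_smul, neg_neg] at h
  exact smul_right_injective _ hs h

/-- When `m ∣ k` the matrix has eigenvalue `±1` but may be a Jordan block, so only one fixed vector
is certain. -/
theorem exists_mulVec_pow_eq {A : Matrix (Fin 2) (Fin 2) ℝ} {k m : ℕ} (hm : 1 ≤ m)
    (hdet : A 0 0 * A 1 1 - A 0 1 * A 1 0 = 1)
    (htr : A 0 0 + A 1 1 = 2 * Real.cos (Real.pi * ((k : ℝ) / m))) :
    ∃ v ≠ 0, (A ^ (2 * m)).mulVec v = v := by
  by_cases hk : m ∣ k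
  · obtain ⟨j, rfl⟩ := hk
    have e : Real.pi * (((m * j : ℕ) : ℝ) / m) = j * Real.pi := by
      push_cast
      field_simp
    rw [e, Real.cos_nat_mul_pi] at htr
    set ε : ℝ := (-1) ^ j
    have hε : ε ^ 2 = 1 := by rw [← pow_mul, mul_comm, pow_mul]; simp
    have hd : (A - ε • (1 : Matrix (Fin 2) (Fin 2) ℝ)).det = 0 := by
      rw [Matrix.det_fin_two]
      simp
      linear_combination hdet - ε * htr - hε
    obtain ⟨v, hv, hAv⟩ := Matrix.exists_mulVec_eq_zero_iff.2 hd
    rw [Matrix.sub_mulVec, Matrix.smul_mulVec, Matrix.one_mulVec, sub_eq_zero] at hAv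
    have h2 : (A ^ 2).mulVec v = v := by
      rw [sq, ← Matrix.mulVec_mulVec, hAv, Matrix.mulVec_smul, hAv, smul_smul, ← sq, hε, one_smul]
    refine ⟨v, hv, ?_⟩
    rw [pow_mul]
    clear hm e
    induction m with
    | zero => simp
    | succ m ih => rw [pow_succ, ← Matrix.mulVec_mulVec, h2, ih]
  · rw [pow_eq_one_of_trace hm hk hdet htr]
    exact ⟨1, one_ne_zero, Matrix.one_mulVec _⟩

end LinearAlgebra

/-! ### Periodic sequences -/

theorem Function.Periodic.map_emod {α : Type*} {f : ℤ → α} {N : ℤ} (h : Function.Periodic f N)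
    (i : ℤ) : f (i % N) = f i := by
  have := h.int_mul (i / N) (i % N)
  rwa [Int.cast_id, mul_comm, Int.emod_add_mul_ediv, eq_comm] at this

theorem finrank_radiiSpace (N : ℕ) [NeZero N] : Module.finrank ℝ (radiiSpace N) = N := by
  let f : radiiSpace N →ₗ[ℝ] (Fin N → ℝ) :=
    { toFun := fun r j ↦ r.1 (j : ℕ)
      map_add' := fun _ _ ↦ rfl
      map_smul' := fun _ _ ↦ rfl }
  have hN : (0 : ℤ) < N := by exact_mod_cast NeZero.pos N
  have hlt (i : ℤ) : (i % N).toNat < N := by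
    have h1 := Int.emod_nonneg i hN.ne'
    have h2 := Int.emod_lt_of_pos i hN
    omega
  have hbij : Function.Bijective f := by
    constructor
    · intro r s hrs
      ext i
      have h1 := congrFun hrs ⟨_, hlt i⟩
      have h2 : (((i % N).toNat : ℕ) : ℤ) = i % N := Int.toNat_of_nonneg (Int.emod_nonneg i hN.ne')
      simp only [f, LinearMap.coe_mk, AddHom.coe_mk, h2] at h1
      have hr : Function.Periodic r.1 N := r.2
      have hs : Function.Periodic s.1 N := s.2
      rwa [hr.map_emod, hs.map_emod] at h1
    · intro g
      refine ⟨⟨fun i ↦ g ⟨_, hlt i⟩, fun i ↦ ?_⟩, ?_⟩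
      · simp
      · ext j
        simp only [f, LinearMap.coe_mk, AddHom.coe_mk]
        congr 1
        ext
        simp only
        rw [Int.emod_eq_of_lt (by omega) (by omega)]
        simp
  rw [(LinearEquiv.ofBijective f hbij).finrank_eq, Module.finrank_fin_fun]

/-! ### Convex geometry of the polygon and its monodromy -/

namespace SymmetricConvexPolygon

variable {n : ℕ} (P : SymmetricConvexPolygon n)

theorem not_modEq {n : ℕ} {x y : ℤ} (h1 : 0 < x - y) (h2 : x - y < 2 * n) :
    ¬ x ≡ y [ZMOD (2 * n : ℤ)] := fun h ↦ by
  have := Int.le_of_dvd h1 h.symm.dvd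
  omega

theorem det2_edge_succ_pos (i : ℤ) :
    0 < det2 (P.vertex (i + 1) - P.vertex i) (P.vertex (i + 2) - P.vertex (i + 1)) := by
  have hn := P.two_le
  have h := P.convex i (i + 2) (not_modEq (by omega) (by omega)) (not_modEq (by omega) (by omega))
  simp only [det2, Prod.fst_sub, Prod.snd_sub] at h ⊢
  linarith

/-- Less than half a turn separates an edge from the next `n - 1` edges. -/
theorem det2_edge_pos (i : ℕ) (hi : i + 1 < n) :
    0 < det2 (P.vertex (0 + 1) - P.vertex 0)
      (P.vertex ((i : ℤ) + 2) - P.vertex ((i : ℤ) + 1)) := by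
  have hn := P.two_le
  induction i with
  | zero => simpa using P.det2_edge_succ_pos 0
  | succ i ih =>
    have h1 := ih (by omega)
    push_cast
    have e : (i : ℤ) + 1 + 1 = i + 2 := by ring
    rw [e]
    by_contra h2
    rw [not_lt] at h2
    -- `-P (i + 2)` lies to the left of the first side and `P n = -P 0`; the inequality is that fact
    -- moved by symmetry.
    have h3 : 0 < det2 (P.vertex (0 + 1) - P.vertex 0)
        (P.vertex (0 + n) - P.vertex ((i : ℤ) + 2)) := by
      have h := P.convex 0 (i + 2 + n) (not_modEq (by omega) (by omega))
        (not_modEq (by omega) (by omega))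
      rw [P.symm] at h ⊢
      simp only [det2, Prod.fst_sub, Prod.snd_sub, Prod.fst_neg, Prod.snd_neg] at h ⊢
      linarith
    rw [zero_add (n : ℤ)] at h3
    have h4 := P.convex (i + 1) n (not_modEq (by omega) (by omega))
      (not_modEq (by omega) (by omega))
    have h5 := P.det2_edge_succ_pos (i + 1)
    have h6 : 0 ≤ det2 (P.vertex ((i : ℤ) + 1 + 2) - P.vertex ((i : ℤ) + 2))
        (P.vertex n - P.vertex ((i : ℤ) + 2)) := by
      by_cases hin : n = i + 3
      · rw [show (n : ℤ) = i + 1 + 2 by omega]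
        simp only [det2]
        linarith
      · have h := P.convex (i + 2) n (not_modEq (by omega) (by omega))
          (not_modEq (by omega) (by omega))
        rw [show (i : ℤ) + 2 + 1 = i + 1 + 2 by ring] at h
        exact h.le
    rw [e] at h4 h5
    simp only [det2, Prod.fst_sub, Prod.snd_sub, zero_add] at h1 h2 h3 h4 h5 h6
    generalize (P.vertex 1).1 - (P.vertex 0).1 = a1 at *
    generalize (P.vertex 1).2 - (P.vertex 0).2 = a2 at *
    generalize (P.vertex ((i : ℤ) + 1)).1 = b1 at *
    generalize (P.vertex ((i : ℤ) + 1)).2 = b2 at *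
    generalize (P.vertex ((i : ℤ) + 2)).1 = c1 at *
    generalize (P.vertex ((i : ℤ) + 2)).2 = c2 at *
    generalize (P.vertex ((i : ℤ) + 1 + 2)).1 = d1 at *
    generalize (P.vertex ((i : ℤ) + 1 + 2)).2 = d2 at *
    generalize (P.vertex n).1 = v1 at *
    generalize (P.vertex n).2 = v2 at *
    have h7 := mul_nonneg h6 h1.le
    have h4' : 0 < (c1 - b1) * (v2 - c2) - (c2 - b2) * (v1 - c1) := by linarith
    have h8 := mul_nonneg h4'.le (neg_nonneg.2 h2)
    have h9 := mul_pos h5 h3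
    -- The Plücker relation between the first edge, two consecutive edges and the vector from their
    -- common vertex to `P n`: the left side is positive, the right side non-positive.
    have h10 : ((c1 - b1) * (d2 - c2) - (c2 - b2) * (d1 - c1)) *
        (a1 * (v2 - c2) - a2 * (v1 - c1)) =
        -(((d1 - c1) * (v2 - c2) - (d2 - c2) * (v1 - c1)) *
          (a1 * (c2 - b2) - a2 * (c1 - b1))) -
        ((c1 - b1) * (v2 - c2) - (c2 - b2) * (v1 - c1)) *
          -(a1 * (d2 - c2) - a2 * (d1 - c1)) := by ring
    linarith

theorem det2_dual (i j : ℤ) : det2 (P.dual i) (P.dual j) =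
    P.beta i * P.beta j *
      det2 (P.vertex (i + 1) - P.vertex i) (P.vertex (j + 1) - P.vertex j) := by
  simp only [dual, beta, det2, Prod.smul_fst, Prod.smul_snd, smul_eq_mul]
  ring

theorem beta_pos (i : ℤ) : 0 < P.beta i := one_div_pos.2 (P.det_pos i)

theorem det2_dual_succ_pos (i : ℤ) : 0 < det2 (P.dual i) (P.dual (i + 1)) := by
  rw [det2_dual]
  have h := P.det2_edge_succ_pos i
  rw [show i + 2 = i + 1 + 1 by ring] at h
  exact mul_pos (mul_pos (P.beta_pos _) (P.beta_pos _)) h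

theorem alpha_pos (i : ℤ) : 0 < P.alpha i := one_div_pos.2 (P.det2_dual_succ_pos i)

/-- Positivity, inside the half period, of the Dirichlet solution at `z = 1`: the input to
`one_le_of_antiperiodic`. -/
theorem det2_dual_zero_pos (i : ℕ) (h0 : 0 < i) (hi : i < n) :
    0 < det2 (P.dual 0) (P.dual i) := by
  obtain ⟨k, rfl⟩ := Nat.exists_eq_succ_of_ne_zero h0.ne'
  rw [det2_dual]
  have h := P.det2_edge_pos k hi
  rw [show (k : ℤ) + 2 = (k + 1 : ℕ) + 1 by push_cast; ring,
    show (k : ℤ) + 1 = (k + 1 : ℕ) by push_cast; ring] at h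
  exact mul_pos (mul_pos (P.beta_pos _) (P.beta_pos _)) h

theorem vertex_succ (i : ℤ) : P.vertex (i + 1) = P.vertex i + (P.beta i)⁻¹ • P.dual i := by
  have h := (P.det_pos i).ne'
  rw [dual, beta, smul_smul, inv_mul_cancel₀ (one_div_ne_zero h), one_smul]
  abel

theorem det2_vertex_dual (i : ℤ) : det2 (P.vertex i) (P.dual i) = 1 :=
  ((P.isDual_iff i _).2 rfl).1

/-- `Q i` and `Q (i + 1)` have the same determinant with `P (i + 1)`, so they differ by a multiple
of it. With `vertex_succ`, this says that `([w, Q i], -[w, P i])` solves the system at `z = 1` for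
every fixed `w`. -/
theorem dual_succ (i : ℤ) :
    P.dual (i + 1) = P.dual i - (P.alpha i)⁻¹ • P.vertex (i + 1) := by
  have h1 := P.det2_vertex_dual (i + 1)
  have h2 : det2 (P.vertex (i + 1)) (P.dual i) = 1 := by
    have h3 := (P.isDual_iff i _).2 rfl
    simp only [det2, Prod.fst_sub, Prod.snd_sub] at h3 ⊢
    linarith
  rw [alpha, one_div, inv_inv]
  simp only [det2] at h1 h2 ⊢
  ext
  · simp
    linear_combination (P.dual i).1 * h1 - (P.dual (i + 1)).1 * h2
  · simp
    linear_combination (P.dual i).2 * h1 - (P.dual (i + 1)).2 * h2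

theorem dual_add (i : ℤ) : P.dual (i + n) = -P.dual i := by
  simp only [dual, add_right_comm i _ 1, P.symm]
  ext <;> simp [det2] <;> ring

theorem alpha_add (i : ℤ) : P.alpha (i + n) = P.alpha i := by
  simp [alpha, add_right_comm i _ 1, dual_add, det2]

theorem beta_add (i : ℤ) : P.beta (i + n) = P.beta i := by
  simp [beta, add_right_comm i _ 1, P.symm, det2]

/-- The transfer matrix of `T_P r = z r`, acting on the pairs
`(r i, alpha (i - 1) * (r i - r (i - 1)))`. -/
noncomputable def transfer (z : ℝ) : ℕ → Matrix (Fin 2) (Fin 2) ℝ :=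
  transferMatrix (fun i ↦ (P.alpha i)⁻¹) (fun i ↦ (P.beta i)⁻¹) z

/-- For `z = 1` the solutions are linear functions of the vertices of the dual polygon. -/
theorem transfer_one_apply (i : ℕ) :
    P.transfer 1 i 0 0 = det2 (P.vertex 0) (P.dual i) ∧
    P.transfer 1 i 1 0 = -det2 (P.vertex 0) (P.vertex i) ∧
    P.transfer 1 i 0 1 = det2 (P.dual 0) (P.dual i) ∧
    P.transfer 1 i 1 1 = -det2 (P.dual 0) (P.vertex i) := by
  induction i with
  | zero =>
    have h := P.det2_vertex_dual 0
    simp [transfer, h]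
    simp only [det2] at h ⊢
    refine ⟨by ring, by ring, by linarith⟩
  | succ i ih =>
    obtain ⟨h1, h2, h3, h4⟩ := ih
    have h2' : P.transfer 1 (i + 1) 1 0 = -det2 (P.vertex 0) (P.vertex (i + 1 : ℕ)) := by
      rw [transfer] at h1 h2 ⊢
      rw [transferMatrix_succ_one, h1, h2]
      push_cast
      rw [P.vertex_succ i]
      simp [det2]
      ring
    have h4' : P.transfer 1 (i + 1) 1 1 = -det2 (P.dual 0) (P.vertex (i + 1 : ℕ)) := by
      rw [transfer] at h3 h4 ⊢
      rw [transferMatrix_succ_one, h3, h4]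
      push_cast
      rw [P.vertex_succ i]
      simp [det2]
      ring
    refine ⟨?_, h2', ?_, h4'⟩
    · rw [transfer] at h1 h2' ⊢
      rw [transferMatrix_succ_zero, h1, h2']
      push_cast
      rw [P.dual_succ i]
      simp [det2]
      ring
    · rw [transfer] at h3 h4' ⊢
      rw [transferMatrix_succ_zero, h3, h4']
      push_cast
      rw [P.dual_succ i]
      simp [det2]
      ring

/-- Vertices and dual vertices change sign after `n` steps. -/
theorem transfer_one_eq : P.transfer 1 n = -1 := by
  obtain ⟨h1, h2, h3, h4⟩ := P.transfer_one_apply n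
  have hd := P.det2_vertex_dual 0
  have hq := P.dual_add 0
  have hp := P.symm 0
  rw [zero_add] at hq hp
  rw [hq] at h1 h3
  rw [hp] at h2 h4
  simp only [det2, Prod.fst_neg, Prod.snd_neg] at *
  ext i j
  fin_cases i <;> fin_cases j <;> simp [h1, h2, h3, h4] <;> linarith

theorem transfer_mul_period (z : ℝ) (m : ℕ) :
    P.transfer z (2 * m * n) = P.transfer z n ^ (2 * m) :=
  transferMatrix_mul (fun i ↦ by push_cast; rw [P.alpha_add]) (fun i ↦ by push_cast; rw [P.beta_add])
    (2 * m)

theorem period_pos {n : ℕ} (P : SymmetricConvexPolygon n) {m : ℕ} (hm : 1 ≤ m) : 0 < 2 * m * n := by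
  have := P.two_le
  positivity

/-! ### From the monodromy to eigenspaces -/

/-- The vectors fixed by the monodromy extend to eigenvectors of the double evolute transform. -/
theorem finrank_ker_le_finrank_eigenspace {m : ℕ} (hm : 1 ≤ m) (z : ℝ) :
    Module.finrank ℝ (LinearMap.ker (P.transfer z (2 * m * n) - 1).mulVecLin) ≤
      Module.finrank ℝ (Module.End.eigenspace (P.doubleEvolute m) z) := by
  set N := 2 * m * n with hNdef
  have hN0 : 0 < N := P.period_pos hm
  have hN : (0 : ℤ) < N := by exact_mod_cast hN0
  have : NeZero N := ⟨hN0.ne'⟩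
  have hfin : Module.Finite ℝ (radiiSpace N) := Module.finite_of_finrank_pos (by
    rw [finrank_radiiSpace]
    exact hN0)
  -- The solution is computed on one period and repeated; the recursion survives the wrap-around
  -- because `v` is fixed by the monodromy.
  let Y (v : Fin 2 → ℝ) (i : ℤ) : Fin 2 → ℝ := (P.transfer z (i % N).toNat).mulVec v
  have hX (v : Fin 2 → ℝ) (hv : (P.transfer z N).mulVec v = v) (i : ℤ) :
      Y v (i + 1) = (P.transfer z ((i % N).toNat + 1)).mulVec v := by
    have h1 := Int.emod_nonneg i hN.ne'
    have h2 := Int.emod_lt_of_pos i hN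
    simp only [Y]
    rw [← Int.emod_add_emod]
    rcases (Int.add_one_le_iff.2 h2).lt_or_eq with h3 | h3
    · rw [Int.emod_eq_of_lt (by omega) h3, show (i % N + 1).toNat = (i % N).toNat + 1 by omega]
    · rw [h3, Int.emod_self, show (i % N).toNat + 1 = N by omega, hv]
      simp [transfer]
  have hα (i : ℤ) : P.alpha ((i % N).toNat : ℤ) = P.alpha i := by
    rw [Int.toNat_of_nonneg (Int.emod_nonneg i hN.ne')]
    exact Function.Periodic.map_emod (P.alpha_add_period m) i
  have hβ (i : ℤ) : P.beta ((i % N).toNat : ℤ) = P.beta i := by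
    rw [Int.toNat_of_nonneg (Int.emod_nonneg i hN.ne')]
    exact Function.Periodic.map_emod (P.beta_add_period m) i
  have hX1 (v : Fin 2 → ℝ) (hv : (P.transfer z N).mulVec v = v) (i : ℤ) :
      Y v (i + 1) 1 = Y v i 1 - z * (P.beta i)⁻¹ * Y v i 0 := by
    rw [hX v hv, ← hβ i]
    simp only [Y, transfer, Matrix.mulVec, dotProduct, Fin.sum_univ_two, transferMatrix_succ_one,
      Algebra.algebraMap_self_apply]
    ring
  have hX0 (v : Fin 2 → ℝ) (hv : (P.transfer z N).mulVec v = v) (i : ℤ) :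
      Y v (i + 1) 0 = Y v i 0 + (P.alpha i)⁻¹ * Y v (i + 1) 1 := by
    rw [hX v hv, ← hα i]
    simp only [Y, transfer, Matrix.mulVec, dotProduct, Fin.sum_univ_two, transferMatrix_succ_zero,
      Algebra.algebraMap_self_apply]
    ring
  have hs (v : Fin 2 → ℝ) (hv : (P.transfer z N).mulVec v = v) (i : ℤ) :
      P.alpha i * (Y v (i + 1) 0 - Y v i 0) = Y v (i + 1) 1 := by
    rw [hX0 v hv]
    have := (P.alpha_pos i).ne'
    field_simp
    ring
  have hfix (v : LinearMap.ker (P.transfer z N - 1).mulVecLin) :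
      (P.transfer z N).mulVec v.1 = v.1 := by
    have := LinearMap.mem_ker.1 v.2
    rwa [Matrix.mulVecLin_apply, Matrix.sub_mulVec, Matrix.one_mulVec, sub_eq_zero] at this
  let Φ : LinearMap.ker (P.transfer z N - 1).mulVecLin →ₗ[ℝ]
      Module.End.eigenspace (P.doubleEvolute m) z :=
    { toFun := fun v ↦ ⟨⟨fun i ↦ Y v.1 i 0, fun i ↦ by
        change Y v.1 (i + N) 0 = Y v.1 i 0
        simp only [Y, Int.add_emod_right]⟩, by
        rw [Module.End.mem_eigenspace_iff]
        ext i
        have hv := hfix v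
        change -P.beta i * (P.alpha i * (Y v.1 (i + 1) 0 - Y v.1 i 0) -
          P.alpha (i - 1) * (Y v.1 (i - 1 + 1) 0 - Y v.1 (i - 1) 0)) = z * Y v.1 i 0
        rw [hs _ hv, hs _ hv, sub_add_cancel, hX1 _ hv]
        have := (P.beta_pos i).ne'
        field_simp
        ring⟩
      map_add' := fun v w ↦ by
        ext i
        change Y (v.1 + w.1) i 0 = Y v.1 i 0 + Y w.1 i 0
        simp only [Y, Matrix.mulVec_add, Pi.add_apply]
      map_smul' := fun c v ↦ by
        ext i
        change Y (c • v.1) i 0 = c * Y v.1 i 0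
        simp only [Y, Matrix.mulVec_smul, Pi.smul_apply, smul_eq_mul] }
  refine LinearMap.finrank_le_finrank_of_injective (f := Φ) ?_
  intro v w hvw
  have h0 (i : ℤ) : Y v.1 i 0 = Y w.1 i 0 := congrFun (congrArg (fun r ↦ r.1.1) hvw) i
  -- The sequence `r` recovers the second initial coordinate as `α (-1) * (r 0 - r (-1))`.
  have h1 : Y v.1 0 1 = Y w.1 0 1 := by
    have hv := hs _ (hfix v) (-1)
    have hw := hs _ (hfix w) (-1)
    rw [neg_add_cancel] at hv hw
    rw [← hv, ← hw, h0, h0]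
  have hY (v : Fin 2 → ℝ) : Y v 0 = v := by
    simp only [Y, transfer, Int.zero_emod, Int.toNat_zero, transferMatrix_zero, Matrix.one_mulVec]
  have h00 := h0 0
  rw [hY, hY] at h00 h1
  ext j
  fin_cases j
  · exact h00
  · exact h1

theorem one_le_finrank_eigenspace {k m : ℕ} (hm : 1 ≤ m) {z : ℝ}
    (hz : P.transfer z n 0 0 + P.transfer z n 1 1 = 2 * Real.cos (Real.pi * ((k : ℝ) / m))) :
    1 ≤ Module.finrank ℝ (Module.End.eigenspace (P.doubleEvolute m) z) := by
  refine le_trans ?_ (P.finrank_ker_le_finrank_eigenspace hm z)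
  obtain ⟨v, hv0, hv⟩ := exists_mulVec_pow_eq hm (transferMatrix_det_eq n) hz
  rw [Submodule.one_le_finrank_iff, Submodule.ne_bot_iff]
  refine ⟨v, ?_, hv0⟩
  rw [LinearMap.mem_ker, Matrix.mulVecLin_apply, Matrix.sub_mulVec, Matrix.one_mulVec, sub_eq_zero,
    P.transfer_mul_period]
  exact hv

theorem two_le_finrank_eigenspace {m : ℕ} (hm : 1 ≤ m) {z : ℝ}
    (hz : P.transfer z n ^ (2 * m) = 1) :
    2 ≤ Module.finrank ℝ (Module.End.eigenspace (P.doubleEvolute m) z) := by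
  refine le_trans ?_ (P.finrank_ker_le_finrank_eigenspace hm z)
  rw [P.transfer_mul_period, hz, sub_self, Matrix.mulVecLin_zero, LinearMap.ker_zero, finrank_top,
    Module.finrank_fin_fun]

/-- The discriminant of the polygon. -/
noncomputable def disc : ℝ[X] :=
  discriminant (fun i ↦ (P.alpha i)⁻¹) (fun i ↦ (P.beta i)⁻¹) n

theorem eval_disc (x : ℝ) : P.disc.eval x = P.transfer x n 0 0 + P.transfer x n 1 1 :=
  eval_discriminant x

theorem transfer_pow_eq_one_of_derivative {x : ℝ} {m : ℕ} (hx : |P.disc.eval x| ≤ 2)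
    (h : (derivative P.disc).eval x = 0) : P.transfer x n ^ (2 * m) = 1 := by
  obtain ⟨h1, h2, h3⟩ := transferMatrix_eq_of_derivative_eq_zero P.two_le
    (fun i ↦ inv_pos.2 (P.alpha_pos i)) (fun i ↦ inv_pos.2 (P.beta_pos i)) hx h
  have hd : P.transfer x n 0 0 * P.transfer x n 1 1 - P.transfer x n 0 1 * P.transfer x n 1 0 = 1 :=
    transferMatrix_det_eq n
  change P.transfer x n 0 1 = 0 at h1
  change P.transfer x n 1 0 = 0 at h2
  change P.transfer x n 0 0 = P.transfer x n 1 1 at h3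
  rw [pow_mul]
  have hsq : P.transfer x n ^ 2 = 1 := by
    rw [h1, h3] at hd
    ext i j
    fin_cases i <;> fin_cases j <;> simp [sq, Matrix.mul_apply, Fin.sum_univ_two, h1, h2, h3] <;>
      linarith
  rw [hsq, one_pow]

theorem exists_eigenvalue_functions : ∃ l1 l2 : ℚ → ℝ, (l1 0 = 0 ∧ l2 0 = 0) ∧ l1 n = l2 n ∧
    (l1 1 = 1 ∧ l2 1 = 1) ∧
    (∀ q : ℚ, 0 ≤ q → q ≤ n → P.disc.eval (l1 q) = 2 * Real.cos (Real.pi * q) ∧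
      P.disc.eval (l2 q) = 2 * Real.cos (Real.pi * q) ∧ l1 q ≤ l2 q) ∧
    (∀ q r : ℚ, 0 ≤ q → q < r → r ≤ n → l2 q < l1 r) ∧
    (∀ q : ℚ, 0 ≤ q → q ≤ n → (∀ k : ℕ, q ≠ k) → l1 q = l2 q) ∧
    (∀ k : ℕ, 0 < k → k < n → l1 k = l2 k → (derivative P.disc).eval (l1 k) = 0) := by
  have ha : ∀ i : ℕ, 0 < (P.alpha i)⁻¹ := fun i ↦ inv_pos.2 (P.alpha_pos i)
  have hb : ∀ i : ℕ, 0 < (P.beta i)⁻¹ := fun i ↦ inv_pos.2 (P.beta_pos i)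
  obtain ⟨ξ, hξ⟩ := exists_isBandPartition_discriminant P.two_le ha hb
  obtain ⟨l1, l2, h0, hn, hv, hm, hne, hd, h1⟩ :=
    hξ.exists_eigenvalue_functions P.two_le eval_zero_discriminant
  refine ⟨l1, l2, h0, hn, h1 ?_ ?_ ?_, hv, hm, hne, hd⟩
  · refine (P.eval_disc 1).trans ?_
    rw [P.transfer_one_eq]
    simp
    norm_num
  · exact eval_derivative_discriminant_eq_zero (c := -1) (P.transfer_one_eq.trans (by simp))
  · intro x hx
    refine one_le_of_antiperiodic P.two_le ha hb P.transfer_one_eq (fun i hi hin ↦ ?_) hx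
    exact (P.det2_dual_zero_pos i hi hin).trans_eq (P.transfer_one_apply i).2.2.1.symm

/-! ### The spectrum and the count of cycloids -/

/-- Both parities share the index `(j + 1) / 2`, so positions `2k - 1` and `2k` belong to `k / m`.
-/
theorem interleave_eq_or (m : ℕ) (l1 l2 : ℚ → ℝ) (j : ℕ) :
    (j % 2 = 1 ∧ interleave m l1 l2 j = l1 (((j + 1) / 2 : ℕ) / m)) ∨
      (j % 2 = 0 ∧ interleave m l1 l2 j = l2 (((j + 1) / 2 : ℕ) / m)) := by
  rcases Nat.mod_two_eq_zero_or_one j with h | h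
  · right
    rw [interleave, if_pos (Nat.even_iff.2 h), show (j + 1) / 2 = j / 2 by omega]
    exact ⟨h, rfl⟩
  · left
    rw [interleave, if_neg (by rw [Nat.even_iff]; omega)]
    exact ⟨h, rfl⟩

/-- Values at different indices differ, so a value occurs at most twice, and then as `l1 = l2` at
one index. Once the list is established, every dimension is a count of positions. -/
theorem spectrum_doubleEvolute {l1 l2 : ℚ → ℝ} (h0 : l1 0 = 0 ∧ l2 0 = 0)
    (h1 : l1 1 = 1 ∧ l2 1 = 1)
    (hv : ∀ q : ℚ, 0 ≤ q → q ≤ n → P.disc.eval (l1 q) = 2 * Real.cos (Real.pi * q) ∧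
      P.disc.eval (l2 q) = 2 * Real.cos (Real.pi * q) ∧ l1 q ≤ l2 q)
    (hlt : ∀ q r : ℚ, 0 ≤ q → q < r → r ≤ n → l2 q < l1 r)
    (hne : ∀ q : ℚ, 0 ≤ q → q ≤ n → (∀ k : ℕ, q ≠ k) → l1 q = l2 q)
    (hd : ∀ k : ℕ, 0 < k → k < n → l1 k = l2 k → (derivative P.disc).eval (l1 k) = 0)
    {m : ℕ} (hm : 1 ≤ m) :
    IsEigenvalueList (P.doubleEvolute m) (fun j : Fin (2 * m * n) => interleave m l1 l2 j) ∧
      (∀ k : ℕ, k < m * n → l2 ((k : ℚ) / m) < l1 (((k : ℚ) + 1) / m)) ∧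
      (∀ k : ℕ, k ≤ m * n → ¬ m ∣ k →
        l1 ((k : ℚ) / m) = l2 ((k : ℚ) / m) ∧
        Module.finrank ℝ
          (Module.End.eigenspace (P.doubleEvolute m) (l1 ((k : ℚ) / m))) = 2) ∧
      Module.finrank ℝ (P.hypocycloids m) = 2 * m - 2 ∧
      Module.finrank ℝ (P.cycloids m) = 2 ∧
      Module.finrank ℝ (P.epicycloids m) = 2 * m * n - 2 * m - 1 := by
  have hn2 := P.two_le
  have hmq : (0 : ℚ) < m := by exact_mod_cast hm
  have hN : 2 * m * n = 2 * (m * n) := by ring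
  have hmn : 2 * m ≤ m * n := by nlinarith
  have hq0 (k : ℕ) : (0 : ℚ) ≤ k / m := by positivity
  have hqn (k : ℕ) (hk : k ≤ m * n) : (k : ℚ) / m ≤ n := by
    rw [div_le_iff₀ hmq, mul_comm]
    exact_mod_cast hk
  have hidx (c d : ℕ) (hcd : c < d) (hdn : d ≤ m * n) : l2 ((c : ℚ) / m) < l1 ((d : ℚ) / m) :=
    hlt _ _ (hq0 c) (div_lt_div_of_pos_right (by exact_mod_cast hcd) hmq) (hqn d hdn)
  have hle (c : ℕ) (hc : c ≤ m * n) : l1 ((c : ℚ) / m) ≤ l2 ((c : ℚ) / m) :=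
    (hv _ (hq0 c) (hqn c hc)).2.2
  have hnint (k : ℕ) (hk : k ≤ m * n) (hmk : ¬ m ∣ k) : l1 ((k : ℚ) / m) = l2 ((k : ℚ) / m) := by
    refine hne _ (hq0 k) (hqn k hk) fun j hj ↦ hmk ⟨j, ?_⟩
    rw [div_eq_iff hmq.ne'] at hj
    rw [mul_comm]
    exact_mod_cast hj
  have hmm : ((m : ℕ) : ℚ) / m = 1 := div_self hmq.ne'
  set ν : Fin (2 * m * n) → ℝ := fun j ↦ interleave m l1 l2 j with hν
  have hbound (j : Fin (2 * m * n)) : l1 ((((j : ℕ) + 1) / 2 : ℕ) / m) ≤ ν j ∧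
      ν j ≤ l2 ((((j : ℕ) + 1) / 2 : ℕ) / m) := by
    have := hle (((j : ℕ) + 1) / 2) (by omega)
    rcases interleave_eq_or m l1 l2 j with ⟨-, h⟩ | ⟨-, h⟩
    · simp only [hν, h]
      exact ⟨le_rfl, this⟩
    · simp only [hν, h]
      exact ⟨this, le_rfl⟩
  have hlow (k : ℕ) (hk : k ≤ m * n) (j : Fin (2 * m * n)) (h : ((j : ℕ) + 1) / 2 < k) :
      ν j < l1 ((k : ℚ) / m) := (hbound j).2.trans_lt (hidx _ _ h hk)
  have hhigh (k : ℕ) (j : Fin (2 * m * n)) (h : k < ((j : ℕ) + 1) / 2) :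
      l2 ((k : ℚ) / m) < ν j := (hidx _ _ h (by omega)).trans_le (hbound j).1
  have htr (j : Fin (2 * m * n)) : P.transfer (ν j) n 0 0 + P.transfer (ν j) n 1 1 =
      2 * Real.cos (Real.pi * (((((j : ℕ) + 1) / 2 : ℕ) : ℝ) / m)) := by
    obtain ⟨e1, e2, -⟩ := hv _ (hq0 (((j : ℕ) + 1) / 2)) (hqn (((j : ℕ) + 1) / 2) (by omega))
    rw [← P.eval_disc]
    push_cast at e1 e2 ⊢
    rcases interleave_eq_or m l1 l2 j with ⟨-, h⟩ | ⟨-, h⟩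
    · simp only [hν, h]
      exact_mod_cast e1
    · simp only [hν, h]
      exact_mod_cast e2
  have hlist : IsEigenvalueList (P.doubleEvolute m) ν := by
    have : NeZero (2 * m * n) := ⟨(P.period_pos hm).ne'⟩
    refine isEigenvalueList_of_card_le (P.period_pos hm) (finrank_radiiSpace _) fun μ ↦ ?_
    have hidx_eq (i j : Fin (2 * m * n)) (hij : ν i = ν j) :
        ((i : ℕ) + 1) / 2 = ((j : ℕ) + 1) / 2 := by
      rcases lt_trichotomy (((i : ℕ) + 1) / 2) (((j : ℕ) + 1) / 2) with h | h | h
      · exact absurd hij ((hlow _ (by omega) i h).trans_le (hbound j).1).ne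
      · exact h
      · exact absurd hij ((hlow _ (by omega) j h).trans_le (hbound i).1).ne'
    by_cases hpair : ∃ i j : Fin (2 * m * n), i < j ∧ ν i = μ ∧ ν j = μ
    · obtain ⟨i, j, hij, hi, hj⟩ := hpair
      have hij' : (i : ℕ) < j := hij
      have hc := hidx_eq i j (hi.trans hj.symm)
      have hcard : (Finset.univ.filter fun l ↦ ν l = μ).card ≤ 2 := by
        refine (Finset.card_le_card (t := {i, j}) fun l hl ↦ ?_).trans Finset.card_le_two
        have hl' := hidx_eq l i ((Finset.mem_filter.1 hl).2.trans hi.symm)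
        rw [Finset.mem_insert, Finset.mem_singleton, Fin.ext_iff, Fin.ext_iff]
        omega
      refine hcard.trans (P.two_le_finrank_eigenspace hm ?_)
      have e1 : μ = l1 ((((i : ℕ) + 1) / 2 : ℕ) / m) := by
        rcases interleave_eq_or m l1 l2 i with ⟨-, h⟩ | ⟨h, -⟩
        · exact hi.symm.trans h
        · omega
      have e2 : μ = l2 ((((i : ℕ) + 1) / 2 : ℕ) / m) := by
        rcases interleave_eq_or m l1 l2 j with ⟨h, -⟩ | ⟨-, h⟩
        · omega
        · rw [hc]
          exact hj.symm.trans h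
      have htri := htr i
      -- A repeated value occupies positions `2c - 1` and `2c`, both within the list; the indices
      -- `0` and `m * n` own one position each.
      have hcpos : 0 < ((i : ℕ) + 1) / 2 := by omega
      have hclt : ((i : ℕ) + 1) / 2 < m * n := by omega
      rw [hi] at htri
      generalize ((i : ℕ) + 1) / 2 = c at *
      -- At an integer index the coincidence makes the derivative of `D` vanish and the monodromy
      -- `±1`; otherwise the monodromy is a rotation-like matrix of finite order.
      by_cases hmc : m ∣ c
      · obtain ⟨k, rfl⟩ := hmc
        have e : ((m * k : ℕ) : ℚ) / m = k := by
          push_cast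
          field_simp
        rw [e] at e1 e2
        have hk0 : 0 < k := Nat.pos_of_mul_pos_left hcpos
        have hkn : k < n := lt_of_mul_lt_mul_left hclt (Nat.zero_le m)
        refine P.transfer_pow_eq_one_of_derivative ?_ (e1 ▸ hd k hk0 hkn (e1.symm.trans e2))
        rw [P.eval_disc, htri, abs_mul, abs_two]
        linarith [Real.abs_cos_le_one (Real.pi * (((m * k : ℕ) : ℝ) / m))]
      · exact pow_eq_one_of_trace hm hmc (transferMatrix_det_eq n) htri
    · push Not at hpair
      rcases (Finset.univ.filter fun l ↦ ν l = μ).eq_empty_or_nonempty with he | ⟨j, hj⟩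
      · rw [he, Finset.card_empty]
        exact Nat.zero_le _
      · have hjμ := (Finset.mem_filter.1 hj).2
        refine le_trans (Finset.card_le_one.2 fun a ha b hb ↦ ?_)
          (P.one_le_finrank_eigenspace hm (hjμ ▸ htr j))
        have ha' := (Finset.mem_filter.1 ha).2
        have hb' := (Finset.mem_filter.1 hb).2
        rcases lt_trichotomy a b with h | h | h
        · exact absurd hb' (hpair a b h ha')
        · exact h
        · exact absurd ha' (hpair b a h hb')
  have hdouble (k : ℕ) (hk0 : 0 < k) (hk : k < m * n) (he : l1 ((k : ℚ) / m) = l2 ((k : ℚ) / m)) :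
      Module.finrank ℝ
        (Module.End.eigenspace (P.doubleEvolute m) (l1 ((k : ℚ) / m))) = 2 := by
    have h := hlist.finrank_iSup_eigenspace {l1 ((k : ℚ) / m)} (lo := 2 * k - 1) (hi := 2 * k + 1)
      (by omega) fun j ↦ by
        rw [Set.mem_singleton_iff]
        rcases lt_trichotomy (((j : ℕ) + 1) / 2) k with h | h | h
        · have := (hlow k hk.le j h).ne
          constructor
          · exact fun h' ↦ absurd h' this
          · omega
        · have hb := hbound j
          rw [h, ← he] at hb
          refine ⟨fun _ ↦ by omega, fun _ ↦ le_antisymm hb.2 hb.1⟩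
        · have := (hhigh k j h).ne'
          rw [← he] at this
          constructor
          · exact fun h' ↦ absurd h' this
          · omega
    rw [iSup_singleton] at h
    rw [h]
    omega
  refine ⟨hlist, ?_, ?_, ?_, ?_, ?_⟩
  · intro k hk
    have := hidx k (k + 1) (Nat.lt_succ_self k) hk
    push_cast at this
    exact this
  · intro k hk hmk
    have he := hnint k hk hmk
    have hk0 : 0 < k := Nat.pos_of_ne_zero fun h ↦ hmk (h ▸ dvd_zero m)
    have hkn : k < m * n := lt_of_le_of_ne hk fun h ↦ hmk (h ▸ dvd_mul_right m n)
    exact ⟨he, hdouble k hk0 hkn he⟩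
  -- Position `0` carries `λ_0 = 0`, and positions `2m - 1`, `2m` carry the double eigenvalue `1`.
  · rw [hypocycloids, hlist.finrank_iSup_eigenspace _ (lo := 1) (hi := 2 * m - 1) (by omega)]
    · omega
    intro j
    rw [Set.mem_Ioo]
    have hz : 0 < ((j : ℕ) + 1) / 2 → 0 < ν j := fun h ↦ by
      have := hhigh 0 j h
      rwa [Nat.cast_zero, zero_div, h0.2] at this
    constructor
    · rintro ⟨ha, hb⟩
      constructor
      · by_contra! hj
        have := (hbound j).2
        rw [show ((j : ℕ) + 1) / 2 = 0 by omega, Nat.cast_zero, zero_div, h0.2] at this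
        exact this.not_gt ha
      · by_contra! hj
        rcases (show m ≤ ((j : ℕ) + 1) / 2 by omega).eq_or_lt with h | h
        · have := (hbound j).1
          rw [← h, hmm, h1.1] at this
          exact this.not_gt hb
        · have := hhigh m j h
          rw [hmm, h1.2] at this
          exact this.not_gt hb
    · rintro ⟨ha, hb⟩
      refine ⟨hz (by omega), ?_⟩
      have := hlow m (by omega) j (by omega)
      rwa [hmm, h1.1] at this
  · have := hdouble m (by omega) (by omega) (by rw [hmm, h1.1, h1.2])
    rwa [hmm, h1.1] at this
  · rw [epicycloids, hlist.finrank_iSup_eigenspace _ (lo := 2 * m + 1) (hi := 2 * m * n) le_rfl]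
    · omega
    intro j
    rw [Set.mem_Ioi]
    constructor
    · intro ha
      refine ⟨?_, j.2⟩
      by_contra! hj
      rcases (show ((j : ℕ) + 1) / 2 ≤ m by omega).eq_or_lt with h | h
      · have := (hbound j).2
        rw [h, hmm, h1.2] at this
        exact this.not_gt ha
      · have := hlow m (by omega) j h
        rw [hmm, h1.1] at this
        exact ha.not_gt this
    · rintro ⟨ha, -⟩
      have := hhigh m j (by omega)
      rwa [hmm, h1.2] at this

end SymmetricConvexPolygon

theorem mainTheorem4 (n : ℕ) (P : SymmetricConvexPolygon n) :
    ∃ lam1 lam2 : ℚ → ℝ,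
      -- the simple eigenvalues `λ_0 = 0` and `λ_n`, and the double eigenvalue `λ_1 = 1`
      (lam1 0 = 0 ∧ lam2 0 = 0) ∧ lam1 n = lam2 n ∧ (lam1 1 = 1 ∧ lam2 1 = 1) ∧
      -- the spectrum of `T_P`, at the integer indices
      IsEigenvalueList (P.doubleEvolute 1)
        (fun j : Fin (2 * 1 * n) => interleave 1 lam1 lam2 j) ∧
      (∀ k : ℕ, k < n → lam2 k < lam1 (k + 1)) ∧
      (∀ k : ℕ, k ≤ n → lam1 k ≤ lam2 k) ∧
      -- the spectrum of `T_{mP}`, at the indices `k / m`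
      ∀ m : ℕ, 1 ≤ m →
        IsEigenvalueList (P.doubleEvolute m)
          (fun j : Fin (2 * m * n) => interleave m lam1 lam2 j) ∧
        (∀ k : ℕ, k < m * n → lam2 ((k : ℚ) / m) < lam1 (((k : ℚ) + 1) / m)) ∧
        (∀ k : ℕ, k ≤ m * n → ¬ m ∣ k →
          lam1 ((k : ℚ) / m) = lam2 ((k : ℚ) / m) ∧
          Module.finrank ℝ
            (Module.End.eigenspace (P.doubleEvolute m) (lam1 ((k : ℚ) / m))) = 2) ∧
        -- the numbers of linearly independent hypocycloids, cycloids and epicycloids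
        Module.finrank ℝ (P.hypocycloids m) = 2 * m - 2 ∧
        Module.finrank ℝ (P.cycloids m) = 2 ∧
        Module.finrank ℝ (P.epicycloids m) = 2 * m * n - 2 * m - 1 := by
  obtain ⟨l1, l2, h0, hn, h1, hv, hlt, hne, hd⟩ := P.exists_eigenvalue_functions
  have key (m : ℕ) (hm : 1 ≤ m) := P.spectrum_doubleEvolute h0 h1 hv hlt hne hd hm
  refine ⟨l1, l2, h0, hn, h1, (key 1 le_rfl).1, fun k hk ↦ ?_, fun k hk ↦ ?_, key⟩
  · exact hlt _ _ (by positivity) (lt_add_one _) (by exact_mod_cast hk)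
  · exact (hv _ (by positivity) (by exact_mod_cast hk)).2.2
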